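/- **Setting.** Let $n\ge 3$, let $M$ be a smooth $n$-dimensional manifold with a smooth Riemannian metric $g$, and let $f$ be a smooth function on $M$ such that, for some constant $\lambda\in\mathbb R$, $$R_{ij}+f_{ij}=\lambda g_{ij},\qquad f_{ij}=\nabla_i\nabla_j f,$$ i.e. $(M,g)$ is a gradient Ricci soliton with potential function $f$ (completeness is not assumed). **Conventions.** $\nabla$ is the Levi-Civita connection; indices refer to arbitrary smooth local coordinates, and repeated indices are contracted with the inverse metric $g^{ij}$. Indices after a comma denote covariant derivatives, taken in the order in which they are written: $T_{\cdots,tk}=\nabla_k\nabla_tT_{\cdots}$ and $T_{\cdots,tki}=\nabla_i\nabla_k\nabla_tT_{\cdots}$. Further $f_i=\nabla_if$. The curvature is $\mathrm{Riem}(X,Y)Z=\nabla_Y\nabla_XZ-\nabla_X\nabla_YZ+\nabla_{[X,Y]}Z$, with $R^l_{ijk}\partial_l=\mathrm{Riem}(\partial_i,\partial_j)\partial_k$ and $R_{ijkl}=g_{lm}R^m_{ijk}$; the Ricci tensor is $R_{ik}=g^{jl}R_{ijkl}$, the scalar curvature is $R=g^{ik}R_{ik}$, and $R_k=\nabla_kR$.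 Put $$W_{ijkl}=R_{ijkl}-\tfrac1{n-2}\left(R_{ik}g_{jl}-R_{il}g_{jk}+R_{jl}g_{ik}-R_{jk}g_{il}\right)+\tfrac{R}{(n-1)(n-2)}\left(g_{ik}g_{jl}-g_{il}g_{jk}\right)$$ (Weyl tensor), $$C_{ijk}=R_{ij,k}-R_{ik,j}-\tfrac1{2(n-1)}\left(R_kg_{ij}-R_jg_{ik}\right)$$ (Cotton tensor), $$B_{ij}=\tfrac1{n-2}\left(C_{jik,k}+R_{kl}W_{ikjl}\right)$$ (Bach tensor), and $$D_{ijk}=\tfrac1{n-2}\left(f_kR_{ij}-f_jR_{ik}\right)+\tfrac1{(n-1)(n-2)}f_t\left(R_{tk}g_{ij}-R_{tj}g_{ik}\right)-\tfrac{R}{(n-1)(n-2)}\left(f_kg_{ij}-f_jg_{ik}\right)$$ (Cao–Chen tensor). **Statement.** At every point of $M$, for all values of the free indices, $$C_{ijk}+f_tW_{tijk}=D_{ijk},$$ $$(n-2)B_{ij}-\frac{n-3}{n-2}\,f_tC_{jit}=D_{ijk,k},$$ $$R_{kt}C_{kti}=(n-2)D_{itk,tk},$$ $$\tfrac12|C|^2+R_{kt}C_{kti,i}=(n-2)D_{itk,tki},$$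 where $|C|^2=C_{ijk}C_{ijk}$. -/

import Mathlib

open scoped Manifold ContDiff Bundle

noncomputable section

namespace RicciSoliton

/-- The coordinate space `ℝⁿ`. -/
abbrev Coord (n : ℕ) : Type := EuclideanSpace ℝ (Fin n)

/-- The partial derivative `∂_i u` of a function of `n` real variables. -/
def pd {n : ℕ} (i : Fin n) (u : Coord n → ℝ) (y : Coord n) : ℝ :=
  fderiv ℝ u y (EuclideanSpace.single i 1)

/-! ### Tensor calculus in one coordinate system

Throughout, `G : Coord n → Matrix (Fin n) (Fin n) ℝ` is the matrix `(g_{ij})` of the components of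
the metric in a coordinate system, as a function of the coordinates. -/

/-- The components `T_{a₀ ⋯ a_{k-1}}(y)` of a covariant tensor field of rank `k` in a coordinate
system, as functions of the multi-index `a` and of the coordinates `y`. -/
abbrev Tensor (n k : ℕ) : Type := (Fin k → Fin n) → Coord n → ℝ

/-- Contraction of two covariant indices with the inverse metric: `g^{ab} F_{ab}` at `y`. -/
def contract {n : ℕ} (G : Coord n → Matrix (Fin n) (Fin n) ℝ) (y : Coord n)
    (F : Fin n → Fin n → ℝ) : ℝ :=
  ∑ a, ∑ b, (G y)⁻¹ a b * F a b

/-- The Christoffel symbols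
`Γ^k_{ij} = ½ g^{kl} (∂_i g_{jl} + ∂_j g_{il} - ∂_l g_{ij})` of the Levi-Civita connection. -/
def christoffel {n : ℕ} (G : Coord n → Matrix (Fin n) (Fin n) ℝ) (k i j : Fin n)
    (y : Coord n) : ℝ :=
  (1 / 2) * ∑ l, (G y)⁻¹ k l *
    (pd i (fun z => G z j l) y + pd j (fun z => G z i l) y - pd l (fun z => G z i j) y)

/-- The covariant derivative of a covariant tensor field; the derivative index comes last:
`T_{a₀ ⋯ a_{k-1}, c} = ∂_c T_{a₀ ⋯ a_{k-1}} - ∑_s Γ^m_{c a_s} T_{a₀ ⋯ m ⋯ a_{k-1}}`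
with `m` in the slot `s`. Iterating it gives `T_{⋯, c d} = ∇_d ∇_c T_⋯`. -/
def covDeriv {n k : ℕ} (G : Coord n → Matrix (Fin n) (Fin n) ℝ) (T : Tensor n k) :
    Tensor n (k + 1) :=
  fun a y =>
    pd (a (Fin.last k)) (T fun s => a s.castSucc) y -
      ∑ s : Fin k, ∑ m : Fin n, christoffel G m (a (Fin.last k)) (a s.castSucc) y *
        T (Function.update (fun r => a r.castSucc) s m) y

/-- The differential `f_i = ∂_i f` of a function. -/
def differential {n : ℕ} (f : Coord n → ℝ) : Tensor n 1 :=
  fun a y => pd (a 0) f y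

/-- The Hessian `f_{ij} = ∇_i ∇_j f`. -/
def hessian {n : ℕ} (G : Coord n → Matrix (Fin n) (Fin n) ℝ) (f : Coord n → ℝ) : Tensor n 2 :=
  fun a y => covDeriv G (differential f) ![a 1, a 0] y

/-- The components `R^l_{ijk}` of the `(3,1)`-curvature, determined by
`R^l_{ijk} ∂_l = Riem(∂_i, ∂_j) ∂_k` with
`Riem(X, Y) Z = ∇_Y ∇_X Z - ∇_X ∇_Y Z + ∇_{[X, Y]} Z`. -/
def riemannUp {n : ℕ} (G : Coord n → Matrix (Fin n) (Fin n) ℝ) (l i j k : Fin n)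
    (y : Coord n) : ℝ :=
  pd j (christoffel G l i k) y - pd i (christoffel G l j k) y +
    ∑ m, (christoffel G m i k y * christoffel G l j m y -
      christoffel G m j k y * christoffel G l i m y)

/-- The `(4,0)`-curvature `R_{ijkl} = g_{lm} R^m_{ijk}`. -/
def riemann {n : ℕ} (G : Coord n → Matrix (Fin n) (Fin n) ℝ) : Tensor n 4 :=
  fun a y => ∑ m, G y (a 3) m * riemannUp G m (a 0) (a 1) (a 2) y

/-- The Ricci tensor `R_{ik} = g^{jl} R_{ijkl}`. -/
def ricci {n : ℕ} (G : Coord n → Matrix (Fin n) (Fin n) ℝ) : Tensor n 2 :=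
  fun a y => contract G y fun j l => riemann G ![a 0, j, a 1, l] y

/-- The scalar curvature `R = g^{ik} R_{ik}`. -/
def scalar {n : ℕ} (G : Coord n → Matrix (Fin n) (Fin n) ℝ) (y : Coord n) : ℝ :=
  contract G y fun i k => ricci G ![i, k] y

/-- The Weyl tensor
`W_{ijkl} = R_{ijkl} - (R_{ik} g_{jl} - R_{il} g_{jk} + R_{jl} g_{ik} - R_{jk} g_{il}) / (n-2)
  + R (g_{ik} g_{jl} - g_{il} g_{jk}) / ((n-1)(n-2))`. -/
def weyl {n : ℕ} (G : Coord n → Matrix (Fin n) (Fin n) ℝ) : Tensor n 4 :=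
  fun a y =>
    let i := a 0
    let j := a 1
    let k := a 2
    let l := a 3
    riemann G ![i, j, k, l] y -
      1 / ((n : ℝ) - 2) *
        (ricci G ![i, k] y * G y j l - ricci G ![i, l] y * G y j k +
          ricci G ![j, l] y * G y i k - ricci G ![j, k] y * G y i l) +
      scalar G y / (((n : ℝ) - 1) * ((n : ℝ) - 2)) * (G y i k * G y j l - G y i l * G y j k)

/-- The Cotton tensor
`C_{ijk} = R_{ij,k} - R_{ik,j} - (R_k g_{ij} - R_j g_{ik}) / (2(n-1))`. -/
def cotton {n : ℕ} (G : Coord n → Matrix (Fin n) (Fin n) ℝ) : Tensor n 3 :=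
  fun a y =>
    let i := a 0
    let j := a 1
    let k := a 2
    covDeriv G (ricci G) ![i, j, k] y - covDeriv G (ricci G) ![i, k, j] y -
      1 / (2 * ((n : ℝ) - 1)) * (pd k (scalar G) y * G y i j - pd j (scalar G) y * G y i k)

/-- The Bach tensor `B_{ij} = (C_{jik,k} + R_{kl} W_{ikjl}) / (n-2)`. -/
def bach {n : ℕ} (G : Coord n → Matrix (Fin n) (Fin n) ℝ) : Tensor n 2 :=
  fun a y =>
    let i := a 0
    let j := a 1
    1 / ((n : ℝ) - 2) *
      ((contract G y fun k k' => covDeriv G (cotton G) ![j, i, k, k'] y) +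
        contract G y fun k k' => contract G y fun l l' =>
          ricci G ![k, l] y * weyl G ![i, k', j, l'] y)

/-- The tensor
`D_{ijk} = (f_k R_{ij} - f_j R_{ik}) / (n-2) + f_t (R_{tk} g_{ij} - R_{tj} g_{ik}) / ((n-1)(n-2))
  - R (f_k g_{ij} - f_j g_{ik}) / ((n-1)(n-2))`. -/
def caoChen {n : ℕ} (G : Coord n → Matrix (Fin n) (Fin n) ℝ) (f : Coord n → ℝ) : Tensor n 3 :=
  fun a y =>
    let i := a 0
    let j := a 1
    let k := a 2
    1 / ((n : ℝ) - 2) * (pd k f y * ricci G ![i, j] y - pd j f y * ricci G ![i, k] y) +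
      1 / (((n : ℝ) - 1) * ((n : ℝ) - 2)) *
        (contract G y fun t t' =>
          pd t f y * (ricci G ![t', k] y * G y i j - ricci G ![t', j] y * G y i k)) -
      scalar G y / (((n : ℝ) - 1) * ((n : ℝ) - 2)) * (pd k f y * G y i j - pd j f y * G y i k)

/-- The squared norm `|T|² = g^{ii'} g^{jj'} g^{kk'} T_{ijk} T_{i'j'k'}` of a tensor of rank 3. -/
def normSq {n : ℕ} (G : Coord n → Matrix (Fin n) (Fin n) ℝ) (T : Tensor n 3) (y : Coord n) : ℝ :=
  contract G y fun i i' => contract G y fun j j' => contract G y fun k k' =>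
    T ![i, j, k] y * T ![i', j', k'] y

/-! ### Riemannian manifolds -/

/-- Smooth Riemannian metrics on a smooth `n`-manifold (without boundary). -/
abbrev Metric (n : ℕ) (M : Type*) [TopologicalSpace M] [ChartedSpace (Coord n) M]
    [IsManifold (𝓡 n) ∞ M] :=
  Bundle.ContMDiffRiemannianMetric (𝓡 n) ∞ (Coord n) (fun x : M => TangentSpace (𝓡 n) x)

/-- The `i`-th coordinate vector field of the chart `e`, at the point with coordinates `y`. -/
def coordVec {n : ℕ} {M : Type*} [TopologicalSpace M] [ChartedSpace (Coord n) M]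
    (e : OpenPartialHomeomorph M (Coord n)) (i : Fin n) (y : Coord n) :
    TangentSpace (𝓡 n) (e.symm y) :=
  mfderiv (𝓡 n) (𝓡 n) e.symm y (EuclideanSpace.single i 1 : Coord n)

/-- The components `g_{ij} = g(∂_i, ∂_j)` of the metric in the chart `e`; meaningful on
`e.target`. -/
def metricCoord {n : ℕ} {M : Type*} [TopologicalSpace M] [ChartedSpace (Coord n) M]
    [IsManifold (𝓡 n) ∞ M] (g : Metric n M) (e : OpenPartialHomeomorph M (Coord n))
    (y : Coord n) : Matrix (Fin n) (Fin n) ℝ :=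
  Matrix.of fun i j => g.inner (e.symm y) (coordVec e i y) (coordVec e j y)

/-- `(M, g)` is a gradient Ricci soliton with potential function `f`: the function `f` is smooth
and for some constant `lam` one has `R_{ij} + f_{ij} = lam g_{ij}` in all smooth local
coordinates. -/
def IsGradientRicciSoliton {n : ℕ} {M : Type*} [TopologicalSpace M] [ChartedSpace (Coord n) M]
    [IsManifold (𝓡 n) ∞ M] (g : Metric n M) (f : M → ℝ) : Prop :=
  ContMDiff (𝓡 n) 𝓘(ℝ, ℝ) ∞ f ∧
    ∃ lam : ℝ, ∀ e ∈ IsManifold.maximalAtlas (𝓡 n) ∞ M, ∀ y ∈ e.target, ∀ i j : Fin n,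
      ricci (metricCoord g e) ![i, j] y + hessian (metricCoord g e) (f ∘ e.symm) ![i, j] y =
        lam * metricCoord g e y i j

end RicciSoliton

end

open RicciSoliton

/-!
The identities are local, so they are proved for the matrix `G` of metric components in one chart:
a smooth symmetric invertible matrix function on an open set `U` of `ℝⁿ` (`IsMetricOn`). That the
matrix of a Riemannian metric in a smooth chart is of this kind is `isMetricOn_metricCoord`.

The tensor calculus rests on three facts about the Christoffel symbols: they are symmetric, the
metric is parallel (`pd_metric`), and so is its inverse, which makes covariant differentiation
commute with contractions (`pd_contract`). The commutator of two covariant derivatives is the Ricci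
identity `covDeriv_comm`; applied to the parallel tensor `g` it gives the antisymmetry of the
curvature in its last two indices. The second Bianchi identity `covDeriv_riemann_cyclic` is, in
matrix form, a consequence of the Jacobi identity for `∂_j Γ_i - ∂_i Γ_j + [Γ_j, Γ_i]`.

In terms of the Schouten tensor `A`, the Weyl tensor is `Riem` minus the Kulkarni–Nomizu product of
`A` and `g`, and the Cotton tensor is `C_{ijk} = (n-2) (A_{ij,k} - A_{ik,j})`. Contracting the
Bianchi identity yields `W_{tijk,k} = -(n-3)/(n-2) C_{jit}` (`contract_covDeriv_weyl`) and
`C_{ijk,i} = 0` (`contract_covDeriv_cotton_first`), hence the symmetry of `C_{ijk,k}` in `i`, `j`.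

On a soliton, the Ricci identity for `df` gives `R_{ij,k} - R_{ik,j} = -f_t R_{tijk}` and, by
contraction, `R_k = 2 f_t R_{tk}`. Inserting both into the definition of `C` proves the first
identity. Its divergence is the second one, because `f_{tk} = λ g_{tk} - R_{tk}` and `W` is trace
free. For the third identity, `D_{itk,t} = -D_{ikt,t}` is expressed by the second one and
differentiated again. The double divergence `C_{ikt,tk}` is half a commutator by the antisymmetry of
`C`, and equals `-½ W_{tkim} C_{mkt} - X_i / (n-2)` with `X_i = R_{kt} C_{kti}`; the term
`R_{ab,k} W_{iakb}` cancels its Weyl part, and only multiples of `X_i` are left over. The last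
identity is the divergence of the third, where `R_{kt,i} C_{kti} = ½ |C|²` since only the part of
`R_{kt,i}` antisymmetric in `t` and `i` contributes.
-/

namespace RicciSoliton

/-! ### Partial derivatives of smooth functions -/

section PartialDerivatives

variable {n : ℕ} {U : Set (Coord n)} {y : Coord n} {u v : Coord n → ℝ}

lemma differentiableAt_of_contDiffOn (hU : IsOpen U) (hy : y ∈ U) (hu : ContDiffOn ℝ ∞ u U) :
    DifferentiableAt ℝ u y :=
  (hu.contDiffAt (hU.mem_nhds hy)).differentiableAt (by simp)

lemma contDiffOn_pd (hU : IsOpen U) (hu : ContDiffOn ℝ ∞ u U) (i : Fin n) :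
    ContDiffOn ℝ ∞ (pd i u) U :=
  (hu.fderiv_of_isOpen hU (by simp)).clm_apply contDiffOn_const

lemma pd_congr (hU : IsOpen U) (hy : y ∈ U) (h : ∀ z ∈ U, u z = v z) (i : Fin n) :
    pd i u y = pd i v y := by
  have : u =ᶠ[nhds y] v := Filter.eventuallyEq_of_mem (hU.mem_nhds hy) h
  simp only [pd, this.fderiv_eq]

lemma pd_add (hu : DifferentiableAt ℝ u y) (hv : DifferentiableAt ℝ v y) (i : Fin n) :
    pd i (fun z => u z + v z) y = pd i u y + pd i v y := by
  simp only [pd, fderiv_fun_add hu hv, add_apply]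

lemma pd_sub (hu : DifferentiableAt ℝ u y) (hv : DifferentiableAt ℝ v y) (i : Fin n) :
    pd i (fun z => u z - v z) y = pd i u y - pd i v y := by
  simp only [pd, fderiv_fun_sub hu hv, sub_apply]

lemma pd_const (c : ℝ) (i : Fin n) : pd i (fun _ => c) y = 0 := by
  simp [pd]

lemma pd_mul (hu : DifferentiableAt ℝ u y) (hv : DifferentiableAt ℝ v y) (i : Fin n) :
    pd i (fun z => u z * v z) y = pd i u y * v y + u y * pd i v y := by
  simp only [pd, fderiv_fun_mul hu hv, add_apply, smul_apply, smul_eq_mul]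
  ring

lemma pd_const_mul (hu : DifferentiableAt ℝ u y) (c : ℝ) (i : Fin n) :
    pd i (fun z => c * u z) y = c * pd i u y := by
  rw [pd_mul (differentiableAt_const c) hu, pd_const]
  ring

lemma pd_sum {ι : Type*} {s : Finset ι} {w : ι → Coord n → ℝ}
    (hw : ∀ a ∈ s, DifferentiableAt ℝ (w a) y) (i : Fin n) :
    pd i (fun z => ∑ a ∈ s, w a z) y = ∑ a ∈ s, pd i (w a) y := by
  simp only [pd, fderiv_fun_sum hw, sum_apply]

/-- Partial derivatives of smooth functions commute. -/
lemma pd_comm (hU : IsOpen U) (hy : y ∈ U) (hu : ContDiffOn ℝ ∞ u U) (i j : Fin n) :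
    pd i (pd j u) y = pd j (pd i u) y := by
  have hsymm : IsSymmSndFDerivAt ℝ u y :=
    (hu.contDiffAt (hU.mem_nhds hy)).isSymmSndFDerivAt
      (by simpa using WithTop.coe_le_coe.2 (le_top : (2 : ℕ∞) ≤ ⊤))
  have hd : DifferentiableAt ℝ (fderiv ℝ u) y :=
    ((hu.fderiv_of_isOpen hU (m := ∞) (by simp)).contDiffAt (hU.mem_nhds hy)).differentiableAt
      (by simp)
  have key : ∀ a b : Fin n, pd a (pd b u) y =
      fderiv ℝ (fderiv ℝ u) y (EuclideanSpace.single a 1) (EuclideanSpace.single b 1) := by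
    intro a b
    have := fderiv_clm_apply hd (differentiableAt_const (EuclideanSpace.single b (1 : ℝ)))
    change fderiv ℝ (fun z => fderiv ℝ u z (EuclideanSpace.single b 1)) y _ = _
    rw [this]
    simp
  rw [key, key, hsymm]

end PartialDerivatives

/-! ### Contraction with the inverse metric at a point -/

section Contraction

variable {n : ℕ} {G : Coord n → Matrix (Fin n) (Fin n) ℝ} {y : Coord n}

lemma contract_congr {F H : Fin n → Fin n → ℝ} (hFH : ∀ a b, F a b = H a b) :
    contract G y F = contract G y H :=
  congrArg (contract G y) (funext fun a => funext fun b => hFH a b)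

lemma contract_add (F H : Fin n → Fin n → ℝ) :
    contract G y (fun a b => F a b + H a b) = contract G y F + contract G y H := by
  simp only [contract, mul_add, Finset.sum_add_distrib]

lemma contract_sub (F H : Fin n → Fin n → ℝ) :
    contract G y (fun a b => F a b - H a b) = contract G y F - contract G y H := by
  simp only [contract, mul_sub, Finset.sum_sub_distrib]

lemma contract_neg (F : Fin n → Fin n → ℝ) :
    contract G y (fun a b => -F a b) = -contract G y F := by
  simp only [contract, mul_neg, Finset.sum_neg_distrib]

lemma contract_const_mul (c : ℝ) (F : Fin n → Fin n → ℝ) :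
    contract G y (fun a b => c * F a b) = c * contract G y F := by
  simp only [contract, Finset.mul_sum]
  exact Finset.sum_congr rfl fun a _ => Finset.sum_congr rfl fun b _ => by ring

lemma contract_mul_const (c : ℝ) (F : Fin n → Fin n → ℝ) :
    contract G y (fun a b => F a b * c) = contract G y F * c := by
  simp only [mul_comm _ c, contract_const_mul]

lemma contract_zero : contract G y (fun _ _ => 0) = 0 := by
  simp [contract]

lemma contract_sum {ι : Type*} (s : Finset ι) (F : ι → Fin n → Fin n → ℝ) :
    contract G y (fun a b => ∑ m ∈ s, F m a b) = ∑ m ∈ s, contract G y (F m) := by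
  simp only [contract, Finset.mul_sum]
  rw [Finset.sum_comm (s := s)]
  refine Finset.sum_congr rfl fun a _ => ?_
  rw [Finset.sum_comm (s := s)]

/-- Contractions over disjoint pairs of indices commute. -/
lemma contract_comm (F : Fin n → Fin n → Fin n → Fin n → ℝ) :
    contract G y (fun a b => contract G y (fun c d => F a b c d)) =
      contract G y (fun c d => contract G y (fun a b => F a b c d)) := by
  change contract G y (fun a b => ∑ c, ∑ d, (G y)⁻¹ c d * F a b c d) = _
  simp only [contract_sum, contract_const_mul]
  rfl

end Contraction

/-! ### Metrics in a coordinate system -/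

/-- `G` is the coordinate matrix of a smooth (possibly indefinite) metric on the open set `U`:
its entries are smooth, and its values on `U` are symmetric and invertible. -/
structure IsMetricOn {n : ℕ} (G : Coord n → Matrix (Fin n) (Fin n) ℝ) (U : Set (Coord n)) :
    Prop where
  isOpen : IsOpen U
  contDiffOn : ∀ i j, ContDiffOn ℝ ∞ (fun z => G z i j) U
  symm : ∀ z ∈ U, ∀ i j, G z i j = G z j i
  det_ne_zero : ∀ z ∈ U, (G z).det ≠ 0

/-- All components of the tensor field `T` are smooth on `U`. -/
def SmoothTensorOn {n k : ℕ} (T : Tensor n k) (U : Set (Coord n)) : Prop :=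
  ∀ a, ContDiffOn ℝ ∞ (T a) U

/-- The metric as a tensor field of rank 2. -/
def metricTensor {n : ℕ} (G : Coord n → Matrix (Fin n) (Fin n) ℝ) : Tensor n 2 :=
  fun a y => G y (a 0) (a 1)

section Metric

variable {n : ℕ} {G : Coord n → Matrix (Fin n) (Fin n) ℝ} {U : Set (Coord n)} {y : Coord n}

namespace IsMetricOn

lemma inv_symm (h : IsMetricOn G U) (hy : y ∈ U) (i j : Fin n) : (G y)⁻¹ i j = (G y)⁻¹ j i := by
  have : (G y).transpose = G y := by ext a b; exact h.symm y hy b a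
  have h2 := congrFun (congrFun (Matrix.transpose_nonsing_inv (G y)) j) i
  rw [this] at h2
  exact h2

lemma sum_inv_mul (h : IsMetricOn G U) (hy : y ∈ U) (i j : Fin n) :
    ∑ b, (G y)⁻¹ i b * G y b j = if i = j then 1 else 0 := by
  have := Matrix.nonsing_inv_mul (G y) (isUnit_iff_ne_zero.2 (h.det_ne_zero y hy))
  have h2 := congrFun (congrFun this i) j
  rwa [Matrix.mul_apply, Matrix.one_apply] at h2

lemma sum_mul_inv (h : IsMetricOn G U) (hy : y ∈ U) (i j : Fin n) :
    ∑ b, G y i b * (G y)⁻¹ b j = if i = j then 1 else 0 := by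
  have := Matrix.mul_nonsing_inv (G y) (isUnit_iff_ne_zero.2 (h.det_ne_zero y hy))
  have h2 := congrFun (congrFun this i) j
  rwa [Matrix.mul_apply, Matrix.one_apply] at h2

lemma contract_swap (h : IsMetricOn G U) (hy : y ∈ U) (F : Fin n → Fin n → ℝ) :
    contract G y (fun a b => F b a) = contract G y (fun a b => F a b) := by
  simp only [contract]
  rw [Finset.sum_comm]
  exact Finset.sum_congr rfl fun a _ => Finset.sum_congr rfl fun b _ => by
    rw [h.inv_symm hy]

/-- Contracting with the metric renames an index. -/
lemma contract_metric (h : IsMetricOn G U) (hy : y ∈ U) (i : Fin n) (F : Fin n → ℝ) :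
    contract G y (fun a b => F a * G y b i) = F i := by
  simp only [contract]
  have : ∀ a, ∑ b, (G y)⁻¹ a b * (F a * G y b i) = F a * if a = i then 1 else 0 := by
    intro a
    rw [← h.sum_inv_mul hy, Finset.mul_sum]
    exact Finset.sum_congr rfl fun b _ => by ring
  simp [this]

lemma contract_metric' (h : IsMetricOn G U) (hy : y ∈ U) (i : Fin n) (F : Fin n → ℝ) :
    contract G y (fun a b => F a * G y i b) = F i := by
  simp only [h.symm y hy i, h.contract_metric hy]

lemma contract_metric_left (h : IsMetricOn G U) (hy : y ∈ U) (i : Fin n) (F : Fin n → ℝ) :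
    contract G y (fun a b => F b * G y a i) = F i := by
  rw [← h.contract_metric hy i F]
  exact h.contract_swap hy (fun a b => F a * G y b i)

lemma contract_metric_left' (h : IsMetricOn G U) (hy : y ∈ U) (i : Fin n) (F : Fin n → ℝ) :
    contract G y (fun a b => F b * G y i a) = F i := by
  simp only [h.symm y hy i, h.contract_metric_left hy]

lemma contract_metric_self (h : IsMetricOn G U) (hy : y ∈ U) :
    contract G y (fun a b => G y a b) = n := by
  have : ∀ a, ∑ b, (G y)⁻¹ a b * G y a b = 1 := fun a => by
    simp only [fun b => h.symm y hy a b]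
    rw [h.sum_inv_mul hy]
    simp
  simp [contract, this]

lemma contract_mul_metric_self (h : IsMetricOn G U) (hy : y ∈ U) (r : ℝ) :
    contract G y (fun a b => r * G y a b) = r * n := by
  rw [← h.contract_metric_self hy]
  exact contract_const_mul r fun a b => G y a b

lemma contDiffOn_inv (h : IsMetricOn G U) (i j : Fin n) :
    ContDiffOn ℝ ∞ (fun z => (G z)⁻¹ i j) U := by
  have hdet : ∀ A : Coord n → Matrix (Fin n) (Fin n) ℝ,
      (∀ i j, ContDiffOn ℝ ∞ (fun z => A z i j) U) → ContDiffOn ℝ ∞ (fun z => (A z).det) U := by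
    intro A hA
    simp only [Matrix.det_apply]
    exact ContDiffOn.sum fun σ _ => (contDiffOn_prod fun k _ => hA _ _).const_smul _
  have hadj : ContDiffOn ℝ ∞ (fun z => (G z).adjugate i j) U := by
    simp only [Matrix.adjugate_apply]
    refine hdet _ fun a b => ?_
    simp only [Matrix.updateRow_apply]
    split_ifs
    · exact contDiffOn_const
    · exact h.contDiffOn _ _
  have : ∀ z, (G z)⁻¹ i j = ((G z).det)⁻¹ * (G z).adjugate i j := by
    intro z
    simp [Matrix.inv_def]
  simp only [this]
  exact ((hdet _ h.contDiffOn).inv h.det_ne_zero).mul hadj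

lemma contDiffOn_christoffel (h : IsMetricOn G U) (k i j : Fin n) :
    ContDiffOn ℝ ∞ (christoffel G k i j) U := by
  unfold christoffel
  refine contDiffOn_const.mul (ContDiffOn.sum fun l _ => (h.contDiffOn_inv _ _).mul ?_)
  exact ((contDiffOn_pd h.isOpen (h.contDiffOn _ _) _).add
    (contDiffOn_pd h.isOpen (h.contDiffOn _ _) _)).sub
    (contDiffOn_pd h.isOpen (h.contDiffOn _ _) _)

lemma contDiffOn_contract (h : IsMetricOn G U) {F : Coord n → Fin n → Fin n → ℝ}
    (hF : ∀ a b, ContDiffOn ℝ ∞ (fun z => F z a b) U) :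
    ContDiffOn ℝ ∞ (fun z => contract G z (F z)) U :=
  ContDiffOn.sum fun a _ => ContDiffOn.sum fun b _ => (h.contDiffOn_inv a b).mul (hF a b)

lemma smooth_covDeriv (h : IsMetricOn G U) {k : ℕ} {T : Tensor n k} (hT : SmoothTensorOn T U) :
    SmoothTensorOn (covDeriv G T) U := fun _ =>
  (contDiffOn_pd h.isOpen (hT _) _).sub <| ContDiffOn.sum fun _ _ => ContDiffOn.sum fun _ _ =>
    (h.contDiffOn_christoffel _ _ _).mul (hT _)

lemma smooth_metricTensor (h : IsMetricOn G U) : SmoothTensorOn (metricTensor G) U :=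
  fun _ => h.contDiffOn _ _

/-- The Levi-Civita connection is torsion free. -/
lemma christoffel_symm (h : IsMetricOn G U) (hy : y ∈ U) (k i j : Fin n) :
    christoffel G k i j y = christoffel G k j i y := by
  simp only [christoffel]
  congr 1
  refine Finset.sum_congr rfl fun l _ => ?_
  rw [pd_congr h.isOpen hy (fun z hz => h.symm z hz i j)]
  ring

lemma sum_metric_mul_christoffel (h : IsMetricOn G U) (hy : y ∈ U) (k i j : Fin n) :
    ∑ m, G y k m * christoffel G m i j y = (1 / 2) *
      (pd i (fun z => G z j k) y + pd j (fun z => G z i k) y - pd k (fun z => G z i j) y) := by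
  simp only [christoffel, Finset.mul_sum]
  rw [Finset.sum_comm]
  have : ∀ l (x : ℝ), ∑ m, G y k m * (1 / 2 * ((G y)⁻¹ m l * x)) =
      (if k = l then 1 else 0) * (1 / 2 * x) := by
    intro l x
    rw [← h.sum_mul_inv hy, Finset.sum_mul]
    exact Finset.sum_congr rfl fun b _ => by ring
  simp only [this]
  simp

/-- The Levi-Civita connection is compatible with the metric. -/
lemma pd_metric (h : IsMetricOn G U) (hy : y ∈ U) (c i j : Fin n) :
    pd c (fun z => G z i j) y =
      ∑ m, christoffel G m c i y * G y m j + ∑ m, christoffel G m c j y * G y i m := by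
  have h1 := h.sum_metric_mul_christoffel hy j c i
  have h2 := h.sum_metric_mul_christoffel hy i c j
  have e1 : ∀ m, christoffel G m c i y * G y m j = G y j m * christoffel G m c i y := fun m => by
    rw [h.symm y hy m j, mul_comm]
  have e2 : ∀ m, christoffel G m c j y * G y i m = G y i m * christoffel G m c j y := fun m =>
    mul_comm _ _
  simp only [e1, e2, h1, h2]
  rw [pd_congr h.isOpen hy (fun z hz => h.symm z hz j i)]
  ring

/-- The inverse metric is parallel. -/
lemma pd_inv (h : IsMetricOn G U) (hy : y ∈ U) (c i j : Fin n) :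
    pd c (fun z => (G z)⁻¹ i j) y =
      -∑ m, christoffel G i c m y * (G y)⁻¹ m j - ∑ m, christoffel G j c m y * (G y)⁻¹ i m := by
  have dG := fun a b => differentiableAt_of_contDiffOn h.isOpen hy (h.contDiffOn a b)
  have dI := fun a b => differentiableAt_of_contDiffOn h.isOpen hy (h.contDiffOn_inv a b)
  -- Differentiate `G⁻¹ G = 1` and multiply by `G⁻¹` from the right.
  have hz : ∀ p, ∑ b, (pd c (fun z => (G z)⁻¹ i b) y * G y b p +
      (G y)⁻¹ i b * pd c (fun z => G z b p) y) = 0 := by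
    intro p
    have h1 : pd c (fun z => ∑ b, (G z)⁻¹ i b * G z b p) y = 0 := by
      rw [pd_congr h.isOpen hy (fun z hz => h.sum_inv_mul hz i p), pd_const]
    rw [pd_sum (fun b _ => (dI i b).fun_mul (dG b p))] at h1
    rw [← h1]
    exact Finset.sum_congr rfl fun b _ => (pd_mul (dI i b) (dG b p) c).symm
  have h3 : ∑ p, (∑ b, (pd c (fun z => (G z)⁻¹ i b) y * G y b p +
      (G y)⁻¹ i b * pd c (fun z => G z b p) y)) * (G y)⁻¹ p j = 0 := by
    simp [hz]
  have hA : ∑ p, ∑ b, pd c (fun z => (G z)⁻¹ i b) y * G y b p * (G y)⁻¹ p j =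
      pd c (fun z => (G z)⁻¹ i j) y := by
    rw [Finset.sum_comm]
    simp only [mul_assoc, ← Finset.mul_sum, h.sum_mul_inv hy]
    simp
  have hB : ∑ p, ∑ b, (G y)⁻¹ i b * (∑ m, christoffel G m c b y * G y m p) * (G y)⁻¹ p j =
      ∑ m, christoffel G j c m y * (G y)⁻¹ i m := by
    rw [Finset.sum_comm]
    refine Finset.sum_congr rfl fun b _ => ?_
    simp only [mul_assoc, ← Finset.mul_sum, Finset.sum_mul]
    rw [Finset.sum_comm]
    simp only [← Finset.mul_sum, h.sum_mul_inv hy]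
    simp [mul_comm]
  have hC : ∑ p, ∑ b, (G y)⁻¹ i b * (∑ m, christoffel G m c p y * G y b m) * (G y)⁻¹ p j =
      ∑ m, christoffel G i c m y * (G y)⁻¹ m j := by
    refine Finset.sum_congr rfl fun p _ => ?_
    rw [← Finset.sum_mul]
    congr 1
    simp only [Finset.mul_sum]
    rw [Finset.sum_comm]
    have : ∀ m b, (G y)⁻¹ i b * (christoffel G m c p y * G y b m) =
      christoffel G m c p y * ((G y)⁻¹ i b * G y b m) := fun m b => by ring
    simp only [this, ← Finset.mul_sum, h.sum_inv_mul hy]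
    simp
  simp only [h.pd_metric hy, mul_add, add_mul, Finset.sum_mul, Finset.sum_add_distrib] at h3
  linarith

/-- Differentiation of a contraction: the two contracted indices may be treated like
covariantly differentiated ones, since the inverse metric is parallel. -/
lemma pd_contract (h : IsMetricOn G U) (hy : y ∈ U) {F : Coord n → Fin n → Fin n → ℝ}
    (hF : ∀ a b, ContDiffOn ℝ ∞ (fun z => F z a b) U) (c : Fin n) :
    pd c (fun z => contract G z (F z)) y = contract G y (fun a b => pd c (fun z => F z a b) y -
      ∑ m, christoffel G m c a y * F y m b - ∑ m, christoffel G m c b y * F y a m) := by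
  have dF := fun a b => differentiableAt_of_contDiffOn h.isOpen hy (hF a b)
  have dI := fun a b => differentiableAt_of_contDiffOn h.isOpen hy (h.contDiffOn_inv a b)
  have e1 : pd c (fun z => contract G z (F z)) y =
      ∑ a, ∑ b, (pd c (fun z => (G z)⁻¹ a b) y * F y a b +
        (G y)⁻¹ a b * pd c (fun z => F z a b) y) := by
    simp only [contract]
    rw [pd_sum fun a _ => DifferentiableAt.fun_sum fun b _ => (dI a b).fun_mul (dF a b)]
    refine Finset.sum_congr rfl fun a _ => ?_
    rw [pd_sum fun b _ => (dI a b).fun_mul (dF a b)]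
    exact Finset.sum_congr rfl fun b _ => pd_mul (dI a b) (dF a b) c
  rw [e1, contract_sub, contract_sub]
  simp only [h.pd_inv hy, contract, sub_mul, neg_mul, Finset.sum_add_distrib,
    Finset.sum_sub_distrib, Finset.sum_neg_distrib, Finset.sum_mul, Finset.mul_sum]
  have hA : ∑ a, ∑ b, ∑ m, christoffel G a c m y * (G y)⁻¹ m b * F y a b =
      ∑ a, ∑ b, ∑ m, (G y)⁻¹ a b * (christoffel G m c a y * F y m b) := by
    simp only [fun a : Fin n => Finset.sum_comm (s := Finset.univ) (t := Finset.univ)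
      (f := fun b m => christoffel G a c m y * (G y)⁻¹ m b * F y a b)]
    rw [Finset.sum_comm]
    refine Finset.sum_congr rfl fun a _ => ?_
    rw [Finset.sum_comm]
    exact Finset.sum_congr rfl fun b _ => Finset.sum_congr rfl fun m _ => by ring
  have hB : ∑ a, ∑ b, ∑ m, christoffel G b c m y * (G y)⁻¹ a m * F y a b =
      ∑ a, ∑ b, ∑ m, (G y)⁻¹ a b * (christoffel G m c b y * F y a m) := by
    refine Finset.sum_congr rfl fun a _ => ?_
    rw [Finset.sum_comm]
    exact Finset.sum_congr rfl fun b _ => Finset.sum_congr rfl fun m _ => by ring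
  rw [hA, hB]
  ring

end IsMetricOn

end Metric

/-! ### Covariant derivatives and the Ricci identity -/

section RicciIdentity

variable {n : ℕ} {G : Coord n → Matrix (Fin n) (Fin n) ℝ} {U : Set (Coord n)} {y : Coord n}

lemma covDeriv_one (T : Tensor n 1) (i c : Fin n) : covDeriv G T ![i, c] y =
    pd c (T ![i]) y - ∑ m, christoffel G m c i y * T ![m] y := by
  have e0 : (fun s : Fin 1 => (![i, c] : Fin 2 → Fin n) s.castSucc) = ![i] := by
    ext s; fin_cases s; rfl
  have e1 : ∀ m, Function.update (![i] : Fin 1 → Fin n) 0 m = ![m] := by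
    intro m; ext s; fin_cases s; rfl
  unfold covDeriv
  rw [e0]
  simp only [Fin.sum_univ_succ, Fin.sum_univ_zero, add_zero]
  simp only [e1]
  rfl

lemma covDeriv_two (T : Tensor n 2) (i j c : Fin n) : covDeriv G T ![i, j, c] y =
    pd c (T ![i, j]) y - ∑ m, christoffel G m c i y * T ![m, j] y -
      ∑ m, christoffel G m c j y * T ![i, m] y := by
  have e0 : (fun s : Fin 2 => (![i, j, c] : Fin 3 → Fin n) s.castSucc) = ![i, j] := by
    ext s; fin_cases s <;> rfl
  have e1 : ∀ m, Function.update (![i, j] : Fin 2 → Fin n) 0 m = ![m, j] := by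
    intro m; ext s; fin_cases s <;> rfl
  have e2 : ∀ m, Function.update (![i, j] : Fin 2 → Fin n) 1 m = ![i, m] := by
    intro m; ext s; fin_cases s <;> rfl
  unfold covDeriv
  rw [e0, Fin.sum_univ_two, ← sub_sub]
  simp only [e1, e2]
  rfl

lemma covDeriv_three (T : Tensor n 3) (i j k c : Fin n) : covDeriv G T ![i, j, k, c] y =
    pd c (T ![i, j, k]) y - ∑ m, christoffel G m c i y * T ![m, j, k] y -
      ∑ m, christoffel G m c j y * T ![i, m, k] y -
      ∑ m, christoffel G m c k y * T ![i, j, m] y := by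
  have e0 : (fun s : Fin 3 => (![i, j, k, c] : Fin 4 → Fin n) s.castSucc) = ![i, j, k] := by
    ext s; fin_cases s <;> rfl
  have e1 : ∀ m, Function.update (![i, j, k] : Fin 3 → Fin n) 0 m = ![m, j, k] := by
    intro m; ext s; fin_cases s <;> rfl
  have e2 : ∀ m, Function.update (![i, j, k] : Fin 3 → Fin n) 1 m = ![i, m, k] := by
    intro m; ext s; fin_cases s <;> rfl
  have e3 : ∀ m, Function.update (![i, j, k] : Fin 3 → Fin n) 2 m = ![i, j, m] := by
    intro m; ext s; fin_cases s <;> rfl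
  unfold covDeriv
  rw [e0, Fin.sum_univ_three, ← sub_sub, ← sub_sub]
  simp only [e1, e2, e3]
  rfl

lemma covDeriv_four (T : Tensor n 4) (i j k l c : Fin n) : covDeriv G T ![i, j, k, l, c] y =
    pd c (T ![i, j, k, l]) y - ∑ m, christoffel G m c i y * T ![m, j, k, l] y -
      ∑ m, christoffel G m c j y * T ![i, m, k, l] y -
      ∑ m, christoffel G m c k y * T ![i, j, m, l] y -
      ∑ m, christoffel G m c l y * T ![i, j, k, m] y := by
  have e0 : (fun s : Fin 4 => (![i, j, k, l, c] : Fin 5 → Fin n) s.castSucc) = ![i, j, k, l] := by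
    ext s; fin_cases s <;> rfl
  have e1 : ∀ m, Function.update (![i, j, k, l] : Fin 4 → Fin n) 0 m = ![m, j, k, l] := by
    intro m; ext s; fin_cases s <;> rfl
  have e2 : ∀ m, Function.update (![i, j, k, l] : Fin 4 → Fin n) 1 m = ![i, m, k, l] := by
    intro m; ext s; fin_cases s <;> rfl
  have e3 : ∀ m, Function.update (![i, j, k, l] : Fin 4 → Fin n) 2 m = ![i, j, m, l] := by
    intro m; ext s; fin_cases s <;> rfl
  have e4 : ∀ m, Function.update (![i, j, k, l] : Fin 4 → Fin n) 3 m = ![i, j, k, m] := by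
    intro m; ext s; fin_cases s <;> rfl
  unfold covDeriv
  rw [e0, Fin.sum_univ_four, ← sub_sub, ← sub_sub, ← sub_sub]
  simp only [e1, e2, e3, e4]
  rfl

lemma covDeriv_five (T : Tensor n 5) (i j k l p c : Fin n) :
    covDeriv G T ![i, j, k, l, p, c] y =
    pd c (T ![i, j, k, l, p]) y - ∑ m, christoffel G m c i y * T ![m, j, k, l, p] y -
      ∑ m, christoffel G m c j y * T ![i, m, k, l, p] y -
      ∑ m, christoffel G m c k y * T ![i, j, m, l, p] y -
      ∑ m, christoffel G m c l y * T ![i, j, k, m, p] y -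
      ∑ m, christoffel G m c p y * T ![i, j, k, l, m] y := by
  have e0 : (fun s : Fin 5 => (![i, j, k, l, p, c] : Fin 6 → Fin n) s.castSucc) =
      ![i, j, k, l, p] := by
    ext s; fin_cases s <;> rfl
  have e1 : ∀ m, Function.update (![i, j, k, l, p] : Fin 5 → Fin n) 0 m = ![m, j, k, l, p] := by
    intro m; ext s; fin_cases s <;> rfl
  have e2 : ∀ m, Function.update (![i, j, k, l, p] : Fin 5 → Fin n) 1 m = ![i, m, k, l, p] := by
    intro m; ext s; fin_cases s <;> rfl
  have e3 : ∀ m, Function.update (![i, j, k, l, p] : Fin 5 → Fin n) 2 m = ![i, j, m, l, p] := by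
    intro m; ext s; fin_cases s <;> rfl
  have e4 : ∀ m, Function.update (![i, j, k, l, p] : Fin 5 → Fin n) 3 m = ![i, j, k, m, p] := by
    intro m; ext s; fin_cases s <;> rfl
  have e5 : ∀ m, Function.update (![i, j, k, l, p] : Fin 5 → Fin n) 4 m = ![i, j, k, l, m] := by
    intro m; ext s; fin_cases s <;> rfl
  unfold covDeriv
  rw [e0, Fin.sum_univ_five, ← sub_sub, ← sub_sub, ← sub_sub, ← sub_sub]
  simp only [e1, e2, e3, e4, e5]
  rfl

lemma covDeriv_congr {k : ℕ} (hU : IsOpen U) (hy : y ∈ U) {S T : Tensor n k}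
    (hST : ∀ a, ∀ z ∈ U, S a z = T a z) (a : Fin (k + 1) → Fin n) :
    covDeriv G S a y = covDeriv G T a y := by
  unfold covDeriv
  rw [pd_congr hU hy (hST _)]
  simp only [hST _ y hy]

lemma covDeriv_zero {k : ℕ} (a : Fin (k + 1) → Fin n) :
    covDeriv G (fun _ _ => 0 : Tensor n k) a y = 0 := by
  simp [covDeriv, pd_const]

/-- The covariant derivative `∇_c T` as a tensor of the same rank as `T`, evaluated at the
multi-index `a`. -/
noncomputable def slotDeriv {k : ℕ} (G : Coord n → Matrix (Fin n) (Fin n) ℝ) (T : Tensor n k)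
    (c : Fin n) (a : Fin k → Fin n) (y : Coord n) : ℝ :=
  pd c (T a) y - ∑ s, ∑ m, christoffel G m c (a s) y * T (Function.update a s m) y

namespace IsMetricOn

lemma pd_slotDeriv (h : IsMetricOn G U) (hy : y ∈ U) {k : ℕ} {T : Tensor n k}
    (hT : SmoothTensorOn T U) (c d : Fin n) (a : Fin k → Fin n) :
    pd d (slotDeriv G T c a) y = pd d (pd c (T a)) y -
      ∑ s, ∑ m, (pd d (christoffel G m c (a s)) y * T (Function.update a s m) y +
        christoffel G m c (a s) y * pd d (T (Function.update a s m)) y) := by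
  have dΓ := fun i j k => differentiableAt_of_contDiffOn h.isOpen hy
    (h.contDiffOn_christoffel i j k)
  have dT := fun a => differentiableAt_of_contDiffOn h.isOpen hy (hT a)
  have dpT := differentiableAt_of_contDiffOn h.isOpen hy (contDiffOn_pd h.isOpen (hT a) c)
  unfold slotDeriv
  rw [pd_sub dpT (DifferentiableAt.fun_sum fun s _ => DifferentiableAt.fun_sum fun m _ =>
    (dΓ _ _ _).fun_mul (dT _)),
    pd_sum (fun s _ => DifferentiableAt.fun_sum fun m _ => (dΓ _ _ _).fun_mul (dT _))]
  congr 1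
  refine Finset.sum_congr rfl fun s _ => ?_
  rw [pd_sum (fun m _ => (dΓ _ _ _).fun_mul (dT _))]
  exact Finset.sum_congr rfl fun m _ => pd_mul (dΓ _ _ _) (dT _) d

lemma covDeriv_covDeriv {k : ℕ} (T : Tensor n k) (b : Fin (k + 2) → Fin n)
    (a : Fin k → Fin n) (c d : Fin n) (ha : ∀ s : Fin k, b s.castSucc.castSucc = a s)
    (hc : b (Fin.last k).castSucc = c) (hd : b (Fin.last (k + 1)) = d) :
    covDeriv G (covDeriv G T) b y = pd d (slotDeriv G T c a) y -
      ∑ s, ∑ m, christoffel G m d (a s) y * slotDeriv G T c (Function.update a s m) y -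
      ∑ m, christoffel G m d c y * slotDeriv G T m a y := by
  have e : ∀ b' : Fin (k + 1) → Fin n, covDeriv G T b' =
      slotDeriv G T (b' (Fin.last k)) (fun s => b' s.castSucc) := fun _ => rfl
  have ha' : (fun s : Fin k => b s.castSucc.castSucc) = a := funext ha
  rw [covDeriv, hd, e, ha', hc, Fin.sum_univ_castSucc, ← sub_sub]
  simp only [e]
  congr 1
  · congr 1
    refine Finset.sum_congr rfl fun s _ => Finset.sum_congr rfl fun m _ => ?_
    rw [ha s]
    congr 2
    · rw [Function.update_of_ne (Fin.castSucc_lt_last s).ne', hc]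
    · ext t
      by_cases hts : t = s
      · subst hts; simp
      · have : t.castSucc ≠ s.castSucc := fun hh => hts (Fin.castSucc_injective _ hh)
        rw [Function.update_of_ne this, Function.update_of_ne hts, ha]
  · refine Finset.sum_congr rfl fun m _ => ?_
    rw [hc, Function.update_self]
    congr 2
    ext t
    rw [Function.update_of_ne (Fin.castSucc_lt_last t).ne, ha]

/-- The **Ricci identity**: the commutator of two covariant derivatives is given by the
curvature. -/
theorem covDeriv_comm (h : IsMetricOn G U) (hy : y ∈ U) {k : ℕ} {T : Tensor n k}
    (hT : SmoothTensorOn T U) (b b' : Fin (k + 2) → Fin n) (a : Fin k → Fin n) (c d : Fin n)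
    (ha : ∀ s : Fin k, b s.castSucc.castSucc = a s)
    (hc : b (Fin.last k).castSucc = c) (hd : b (Fin.last (k + 1)) = d)
    (ha' : ∀ s : Fin k, b' s.castSucc.castSucc = a s)
    (hd' : b' (Fin.last k).castSucc = d) (hc' : b' (Fin.last (k + 1)) = c) :
    covDeriv G (covDeriv G T) b y - covDeriv G (covDeriv G T) b' y =
      -∑ s, ∑ m, riemannUp G m c d (a s) y * T (Function.update a s m) y := by
  rw [covDeriv_covDeriv T b a c d ha hc hd, covDeriv_covDeriv T b' a d c ha' hd' hc',
    h.pd_slotDeriv hy hT, h.pd_slotDeriv hy hT, pd_comm h.isOpen hy (hT a) c d]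
  simp only [h.christoffel_symm hy _ d c]
  -- The terms with two Christoffel symbols, split into those acting twice on the same slot and
  -- those acting on two different slots; the latter are symmetric in `c` and `d`.
  have key : ∀ c d : Fin n,
      ∑ s, ∑ m, christoffel G m d (a s) y * slotDeriv G T c (Function.update a s m) y =
      ∑ s, ∑ m, christoffel G m d (a s) y * pd c (T (Function.update a s m)) y -
      ∑ s, ∑ m, ∑ q, christoffel G m d (a s) y * christoffel G q c m y *
        T (Function.update a s q) y -
      ∑ s, ∑ t, ∑ m, ∑ q, if t = s then 0 else christoffel G m d (a s) y *
        christoffel G q c (a t) y * T (Function.update (Function.update a s m) t q) y := by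
    intro c d
    simp only [← Finset.sum_sub_distrib]
    refine Finset.sum_congr rfl fun s _ => ?_
    rw [Finset.sum_comm (s := Finset.univ) (t := Finset.univ)
      (f := fun t m => ∑ q, if t = s then 0 else christoffel G m d (a s) y *
        christoffel G q c (a t) y * T (Function.update (Function.update a s m) t q) y),
      ← Finset.sum_sub_distrib]
    refine Finset.sum_congr rfl fun m _ => ?_
    have : ∑ t, ∑ q, christoffel G q c (Function.update a s m t) y *
        T (Function.update (Function.update a s m) t q) y =
        ∑ q, christoffel G q c m y * T (Function.update a s q) y +
        ∑ t, ∑ q, if t = s then 0 else christoffel G q c (a t) y *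
          T (Function.update (Function.update a s m) t q) y := by
      rw [← Finset.sum_erase_add _ _ (Finset.mem_univ s), add_comm]
      congr 1
      · simp
      · rw [← Finset.sum_erase_add _ _ (Finset.mem_univ s)]
        simp only [if_true, Finset.sum_const_zero, add_zero]
        refine Finset.sum_congr rfl fun t ht => Finset.sum_congr rfl fun q _ => ?_
        rw [if_neg (Finset.ne_of_mem_erase ht),
          Function.update_of_ne (Finset.ne_of_mem_erase ht)]
    rw [slotDeriv, this, mul_sub, mul_add, ← sub_sub]
    simp only [Finset.mul_sum, mul_ite, mul_zero, mul_assoc]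
  have cross : ∑ s, ∑ t, ∑ m, ∑ q, (if t = s then 0 else christoffel G m d (a s) y *
        christoffel G q c (a t) y * T (Function.update (Function.update a s m) t q) y) =
      ∑ s, ∑ t, ∑ m, ∑ q, (if t = s then 0 else christoffel G m c (a s) y *
        christoffel G q d (a t) y * T (Function.update (Function.update a s m) t q) y) := by
    rw [Finset.sum_comm]
    refine Finset.sum_congr rfl fun s _ => Finset.sum_congr rfl fun t _ => ?_
    rw [Finset.sum_comm]
    refine Finset.sum_congr rfl fun m _ => Finset.sum_congr rfl fun q _ => ?_
    by_cases hst : s = t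
    · simp [hst]
    · rw [if_neg hst, if_neg (Ne.symm hst), Function.update_comm hst,
        mul_comm (christoffel G q d (a t) y)]
  have reidx : ∀ c d : Fin n, ∑ s, ∑ m, ∑ q, christoffel G m d (a s) y * christoffel G q c m y *
        T (Function.update a s q) y = ∑ s, ∑ m, (∑ q, christoffel G q d (a s) y *
          christoffel G m c q y) * T (Function.update a s m) y := by
    intro c d
    refine Finset.sum_congr rfl fun s _ => ?_
    rw [Finset.sum_comm]
    simp only [Finset.sum_mul]
  rw [key c d, key d c, cross, reidx, reidx]
  simp only [riemannUp, Finset.sum_add_distrib, add_mul, sub_mul, Finset.sum_sub_distrib]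
  ring

lemma covDeriv_comm_one (h : IsMetricOn G U) (hy : y ∈ U) {T : Tensor n 1}
    (hT : SmoothTensorOn T U) (i c d : Fin n) :
    covDeriv G (covDeriv G T) ![i, c, d] y - covDeriv G (covDeriv G T) ![i, d, c] y =
      -∑ m, riemannUp G m c d i y * T ![m] y := by
  rw [h.covDeriv_comm hy hT ![i, c, d] ![i, d, c] ![i] c d (fun s => by fin_cases s; rfl) rfl rfl
    (fun s => by fin_cases s; rfl) rfl rfl]
  have e1 : ∀ m, Function.update (![i] : Fin 1 → Fin n) 0 m = ![m] := by
    intro m; ext s; fin_cases s; rfl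
  simp [e1]

lemma covDeriv_comm_two (h : IsMetricOn G U) (hy : y ∈ U) {T : Tensor n 2}
    (hT : SmoothTensorOn T U) (i j c d : Fin n) :
    covDeriv G (covDeriv G T) ![i, j, c, d] y - covDeriv G (covDeriv G T) ![i, j, d, c] y =
      -∑ m, riemannUp G m c d i y * T ![m, j] y - ∑ m, riemannUp G m c d j y * T ![i, m] y := by
  rw [h.covDeriv_comm hy hT ![i, j, c, d] ![i, j, d, c] ![i, j] c d
    (fun s => by fin_cases s <;> rfl) rfl rfl (fun s => by fin_cases s <;> rfl) rfl rfl]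
  have e1 : ∀ m, Function.update (![i, j] : Fin 2 → Fin n) 0 m = ![m, j] := by
    intro m; ext s; fin_cases s <;> rfl
  have e2 : ∀ m, Function.update (![i, j] : Fin 2 → Fin n) 1 m = ![i, m] := by
    intro m; ext s; fin_cases s <;> rfl
  rw [Fin.sum_univ_two]
  simp only [e1, e2, Matrix.cons_val_zero, Matrix.cons_val_one]
  ring

lemma covDeriv_comm_three (h : IsMetricOn G U) (hy : y ∈ U) {T : Tensor n 3}
    (hT : SmoothTensorOn T U) (i j k c d : Fin n) :
    covDeriv G (covDeriv G T) ![i, j, k, c, d] y - covDeriv G (covDeriv G T) ![i, j, k, d, c] y =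
      -∑ m, riemannUp G m c d i y * T ![m, j, k] y -
        ∑ m, riemannUp G m c d j y * T ![i, m, k] y -
        ∑ m, riemannUp G m c d k y * T ![i, j, m] y := by
  rw [h.covDeriv_comm hy hT ![i, j, k, c, d] ![i, j, k, d, c] ![i, j, k] c d
    (fun s => by fin_cases s <;> rfl) rfl rfl (fun s => by fin_cases s <;> rfl) rfl rfl]
  have e1 : ∀ m, Function.update (![i, j, k] : Fin 3 → Fin n) 0 m = ![m, j, k] := by
    intro m; ext s; fin_cases s <;> rfl
  have e2 : ∀ m, Function.update (![i, j, k] : Fin 3 → Fin n) 1 m = ![i, m, k] := by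
    intro m; ext s; fin_cases s <;> rfl
  have e3 : ∀ m, Function.update (![i, j, k] : Fin 3 → Fin n) 2 m = ![i, j, m] := by
    intro m; ext s; fin_cases s <;> rfl
  rw [Fin.sum_univ_three]
  simp only [e1, e2, e3, Matrix.cons_val_zero, Matrix.cons_val_one, Matrix.cons_val]
  ring

end IsMetricOn

end RicciIdentity

/-! ### Symmetries of the curvature tensor and the Bianchi identities -/

section Curvature

variable {n : ℕ} {G : Coord n → Matrix (Fin n) (Fin n) ℝ} {U : Set (Coord n)} {y : Coord n}

lemma covDeriv_add {k : ℕ} (hU : IsOpen U) (hy : y ∈ U) {S T : Tensor n k}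
    (hS : SmoothTensorOn S U) (hT : SmoothTensorOn T U) (b : Fin (k + 1) → Fin n) :
    covDeriv G (fun a z => S a z + T a z) b y = covDeriv G S b y + covDeriv G T b y := by
  simp only [covDeriv, mul_add, Finset.sum_add_distrib]
  rw [pd_add (differentiableAt_of_contDiffOn hU hy (hS _))
    (differentiableAt_of_contDiffOn hU hy (hT _))]
  ring

lemma covDeriv_const_mul {k : ℕ} (hU : IsOpen U) (hy : y ∈ U) {T : Tensor n k}
    (hT : SmoothTensorOn T U) (r : ℝ) (b : Fin (k + 1) → Fin n) :
    covDeriv G (fun a z => r * T a z) b y = r * covDeriv G T b y := by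
  simp only [covDeriv, mul_sub, Finset.mul_sum]
  rw [pd_const_mul (differentiableAt_of_contDiffOn hU hy (hT _))]
  congr 1
  exact Finset.sum_congr rfl fun s _ => Finset.sum_congr rfl fun m _ => by ring

lemma covDeriv_sub {k : ℕ} (hU : IsOpen U) (hy : y ∈ U) {S T : Tensor n k}
    (hS : SmoothTensorOn S U) (hT : SmoothTensorOn T U) (b : Fin (k + 1) → Fin n) :
    covDeriv G (fun a z => S a z - T a z) b y = covDeriv G S b y - covDeriv G T b y := by
  simp only [covDeriv, mul_sub, Finset.sum_sub_distrib]
  rw [pd_sub (differentiableAt_of_contDiffOn hU hy (hS _))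
    (differentiableAt_of_contDiffOn hU hy (hT _))]
  ring

/-- Covariant differentiation commutes with permutations of the slots of a tensor field. -/
lemma covDeriv_comp_perm {k : ℕ} (T : Tensor n k) (σ : Equiv.Perm (Fin k))
    (b b' : Fin (k + 1) → Fin n) (hb : ∀ s : Fin k, b' s.castSucc = b (σ s).castSucc)
    (hl : b' (Fin.last k) = b (Fin.last k)) :
    covDeriv G (fun a => T fun s => a (σ s)) b y = covDeriv G T b' y := by
  have eu : ∀ s m, Function.update (fun s : Fin k => (fun t : Fin k => b t.castSucc) (σ s)) s m =
      fun r => Function.update (fun t : Fin k => b t.castSucc) (σ s) m (σ r) := by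
    intro s m
    ext r
    by_cases hr : r = s
    · subst hr; simp
    · rw [Function.update_of_ne hr, Function.update_of_ne (fun hh => hr (σ.injective hh))]
  simp only [covDeriv, hl, eu, hb]
  congr 1
  exact (Equiv.sum_comp σ _).symm

/-- A symmetry or antisymmetry of a tensor field under a permutation of its slots is inherited by
its covariant derivative. -/
lemma covDeriv_perm {k : ℕ} (hU : IsOpen U) (hy : y ∈ U) {T : Tensor n k} (hT : SmoothTensorOn T U)
    (σ : Equiv.Perm (Fin k)) (ε : ℝ) (hσ : ∀ a, ∀ z ∈ U, T (fun s => a (σ s)) z = ε * T a z)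
    (b b' : Fin (k + 1) → Fin n) (hb : ∀ s : Fin k, b' s.castSucc = b (σ s).castSucc)
    (hl : b' (Fin.last k) = b (Fin.last k)) :
    covDeriv G T b' y = ε * covDeriv G T b y := by
  rw [← covDeriv_comp_perm T σ b b' hb hl, ← covDeriv_const_mul hU hy hT]
  exact covDeriv_congr hU hy hσ b

lemma riemann_eq (i j k l : Fin n) :
    riemann G ![i, j, k, l] y = ∑ m, G y l m * riemannUp G m i j k y := rfl

lemma riemannUp_antisymm (l i j k : Fin n) : riemannUp G l i j k y = -riemannUp G l j i k y := by
  simp only [riemannUp, Finset.sum_sub_distrib]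
  ring

lemma riemann_antisymm_left (i j k l : Fin n) :
    riemann G ![i, j, k, l] y = -riemann G ![j, i, k, l] y := by
  rw [riemann_eq, riemann_eq, ← Finset.sum_neg_distrib]
  exact Finset.sum_congr rfl fun m _ => by rw [riemannUp_antisymm]; ring

namespace IsMetricOn

lemma contDiffOn_riemannUp (h : IsMetricOn G U) (l i j k : Fin n) :
    ContDiffOn ℝ ∞ (riemannUp G l i j k) U := by
  have hΓ := h.contDiffOn_christoffel
  exact ((contDiffOn_pd h.isOpen (hΓ _ _ _) _).sub (contDiffOn_pd h.isOpen (hΓ _ _ _) _)).add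
    (ContDiffOn.sum fun m _ => ((hΓ _ _ _).mul (hΓ _ _ _)).sub ((hΓ _ _ _).mul (hΓ _ _ _)))

lemma smooth_riemann (h : IsMetricOn G U) : SmoothTensorOn (riemann G) U := fun _ =>
  ContDiffOn.sum fun _ _ => (h.contDiffOn _ _).mul (h.contDiffOn_riemannUp _ _ _ _)

lemma smooth_ricci (h : IsMetricOn G U) : SmoothTensorOn (ricci G) U := fun _ =>
  h.contDiffOn_contract fun _ _ => h.smooth_riemann _

lemma contDiffOn_scalar (h : IsMetricOn G U) : ContDiffOn ℝ ∞ (scalar G) U :=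
  h.contDiffOn_contract fun _ _ => h.smooth_ricci _

/-- Contraction with `R^m_{cdi}`, expressed through the curvature tensor with lowered indices. -/
lemma sum_riemannUp_mul (h : IsMetricOn G U) (hy : y ∈ U) (c d i : Fin n) (X : Fin n → ℝ) :
    ∑ m, riemannUp G m c d i y * X m =
      contract G y (fun l m => riemann G ![c, d, i, l] y * X m) := by
  have : ∀ l m, riemann G ![c, d, i, l] y * X m =
      ∑ q, riemannUp G q c d i y * (X m * G y l q) := fun l m => by
    rw [riemann_eq, Finset.sum_mul]
    exact Finset.sum_congr rfl fun q _ => by ring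
  simp only [this, contract_sum, contract_const_mul, h.contract_metric_left hy]

/-- The first Bianchi identity. -/
lemma riemann_cyclic (h : IsMetricOn G U) (hy : y ∈ U) (i j k l : Fin n) :
    riemann G ![i, j, k, l] y + riemann G ![j, k, i, l] y + riemann G ![k, i, j, l] y = 0 := by
  simp only [riemann_eq, ← Finset.sum_add_distrib]
  refine Finset.sum_eq_zero fun m _ => ?_
  have hΓ := fun a b c => pd_congr h.isOpen hy (fun z hz => h.christoffel_symm hz a b c)
  simp only [riemannUp, Finset.sum_sub_distrib]
  rw [hΓ m i k j, hΓ m j i k, hΓ m k j i]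
  simp only [fun q => h.christoffel_symm hy q k i, fun q => h.christoffel_symm hy q j i,
    fun q => h.christoffel_symm hy q k j]
  ring

/-- The metric is parallel. -/
lemma covDeriv_metricTensor (h : IsMetricOn G U) (hy : y ∈ U) (a : Fin 3 → Fin n) :
    covDeriv G (metricTensor G) a y = 0 := by
  have : a = ![a 0, a 1, a 2] := by ext s; fin_cases s <;> rfl
  rw [this, covDeriv_two]
  change pd _ (fun z => G z (a 0) (a 1)) y - ∑ m, christoffel G m (a 2) (a 0) y * G y m (a 1) -
    ∑ m, christoffel G m (a 2) (a 1) y * G y (a 0) m = 0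
  rw [h.pd_metric hy]
  ring

lemma riemann_antisymm_right (h : IsMetricOn G U) (hy : y ∈ U) (i j k l : Fin n) :
    riemann G ![i, j, k, l] y = -riemann G ![i, j, l, k] y := by
  -- the Ricci identity for the parallel tensor field `g`
  have key := h.covDeriv_comm_two hy h.smooth_metricTensor k l i j
  have hz : ∀ b, covDeriv G (covDeriv G (metricTensor G)) b y = 0 := fun b => by
    rw [covDeriv_congr h.isOpen hy (T := fun _ _ => 0)
      (fun a z hz => h.covDeriv_metricTensor hz a), covDeriv_zero]
  rw [hz, hz] at key
  have e1 : ∑ m, riemannUp G m i j k y * metricTensor G ![m, l] y = riemann G ![i, j, k, l] y := by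
    rw [riemann_eq]
    refine Finset.sum_congr rfl fun m _ => ?_
    change _ * G y m l = _
    rw [h.symm y hy m l, mul_comm]
  have e2 : ∑ m, riemannUp G m i j l y * metricTensor G ![k, m] y = riemann G ![i, j, l, k] y := by
    rw [riemann_eq]
    exact Finset.sum_congr rfl fun m _ => mul_comm _ _
  rw [e1, e2] at key
  linarith

lemma riemann_pair_symm (h : IsMetricOn G U) (hy : y ∈ U) (i j k l : Fin n) :
    riemann G ![i, j, k, l] y = riemann G ![k, l, i, j] y := by
  have c1 := h.riemann_cyclic hy i j k l
  have c2 := h.riemann_cyclic hy j k l i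
  have c3 := h.riemann_cyclic hy k l i j
  have c4 := h.riemann_cyclic hy l i j k
  have a := riemann_antisymm_left (G := G) (y := y)
  have b := h.riemann_antisymm_right hy
  linarith [a i j k l, a j k i l, a k i j l, a k l i j, a l i j k, a j k l i, a l j k i, a l i k j,
    b j k i l, b k i j l, b i j k l, b k l i j, b l i k j, b j l i k, b l j k i, b l i j k,
    a j l i k, a j l k i, b l j i k, b i k l j, b i k j l, a i k l j]

lemma ricci_eq (i k : Fin n) :
    ricci G ![i, k] y = contract G y (fun j l => riemann G ![i, j, k, l] y) := rfl

lemma ricci_symm (h : IsMetricOn G U) (hy : y ∈ U) (i j : Fin n) :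
    ricci G ![i, j] y = ricci G ![j, i] y := by
  rw [ricci_eq, ricci_eq, ← h.contract_swap hy]
  refine contract_congr fun a b => ?_
  rw [h.riemann_pair_symm hy]

/-- The second Bianchi identity. -/
lemma covDeriv_riemann_cyclic (h : IsMetricOn G U) (hy : y ∈ U) (i j k l p : Fin n) :
    covDeriv G (riemann G) ![i, j, k, l, p] y + covDeriv G (riemann G) ![j, p, k, l, i] y +
      covDeriv G (riemann G) ![p, i, k, l, j] y = 0 := by
  have hΓ := h.contDiffOn_christoffel
  have dΓ := fun a b c => differentiableAt_of_contDiffOn h.isOpen hy (hΓ a b c)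
  have dpΓ := fun a b c d => differentiableAt_of_contDiffOn h.isOpen hy
    (contDiffOn_pd h.isOpen (hΓ a b c) d)
  have dG := fun a b => differentiableAt_of_contDiffOn h.isOpen hy (h.contDiffOn a b)
  have dR := fun a b c d => differentiableAt_of_contDiffOn h.isOpen hy
    (h.contDiffOn_riemannUp a b c d)
  -- `E p i j m k` differentiates `R^m_{ijk}` covariantly in `m` and `k` only.
  set E : Fin n → Fin n → Fin n → Fin n → Fin n → ℝ := fun p i j m k =>
    pd p (riemannUp G m i j k) y + ∑ q, christoffel G m p q y * riemannUp G q i j k y -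
      ∑ q, christoffel G q p k y * riemannUp G m i j q y with hE
  have hcov : ∀ i j p, covDeriv G (riemann G) ![i, j, k, l, p] y = ∑ m, G y l m * E p i j m k -
      ∑ q, christoffel G q p i y * riemann G ![q, j, k, l] y -
      ∑ q, christoffel G q p j y * riemann G ![i, q, k, l] y := by
    intro i j p
    have e1 : pd p (riemann G ![i, j, k, l]) y =
        ∑ m, (pd p (fun z => G z l m) y * riemannUp G m i j k y +
          G y l m * pd p (riemannUp G m i j k) y) := by
      change pd p (fun z => ∑ m, G z l m * riemannUp G m i j k z) y = _
      rw [pd_sum fun m _ => (dG l m).fun_mul (dR m i j k)]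
      exact Finset.sum_congr rfl fun m _ => pd_mul (dG l m) (dR m i j k) p
    have e2 : ∑ m, (∑ q, christoffel G q p l y * G y q m) * riemannUp G m i j k y =
        ∑ q, christoffel G q p l y * riemann G ![i, j, k, q] y := by
      simp only [riemann_eq, Finset.sum_mul, Finset.mul_sum]
      rw [Finset.sum_comm]
      exact Finset.sum_congr rfl fun m _ => Finset.sum_congr rfl fun q _ => by ring
    have e3 : ∑ m, (∑ q, christoffel G q p m y * G y l q) * riemannUp G m i j k y =
        ∑ m, G y l m * ∑ q, christoffel G m p q y * riemannUp G q i j k y := by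
      simp only [Finset.sum_mul, Finset.mul_sum]
      rw [Finset.sum_comm]
      exact Finset.sum_congr rfl fun m _ => Finset.sum_congr rfl fun q _ => by ring
    have e4 : ∑ q, christoffel G q p k y * riemann G ![i, j, q, l] y =
        ∑ m, G y l m * ∑ q, christoffel G q p k y * riemannUp G m i j q y := by
      simp only [riemann_eq, Finset.mul_sum]
      rw [Finset.sum_comm]
      exact Finset.sum_congr rfl fun m _ => Finset.sum_congr rfl fun q _ => by ring
    rw [covDeriv_four, e1, e4]
    simp only [h.pd_metric hy, hE, mul_sub, mul_add, add_mul, Finset.sum_add_distrib,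
      Finset.sum_sub_distrib]
    rw [e2, e3]
    ring
  -- In matrix form the curvature is `∂_j Γ_i - ∂_i Γ_j + [Γ_j, Γ_i]`.
  have hcyc : ∀ m, E p i j m k + E i j p m k + E j p i m k = 0 := by
    intro m
    let A : Fin n → Matrix (Fin n) (Fin n) ℝ := fun p => Matrix.of fun m k => christoffel G m p k y
    let dA : Fin n → Fin n → Matrix (Fin n) (Fin n) ℝ := fun q p =>
      Matrix.of fun m k => pd q (christoffel G m p k) y
    let ddA : Fin n → Fin n → Fin n → Matrix (Fin n) (Fin n) ℝ := fun r q p =>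
      Matrix.of fun m k => pd r (pd q (christoffel G m p k)) y
    have hR : ∀ i j m k, riemannUp G m i j k y = (dA j i - dA i j + A j * A i - A i * A j) m k := by
      intro i j m k
      simp only [riemannUp, A, dA, Matrix.sub_apply, Matrix.add_apply, Matrix.mul_apply,
        Matrix.of_apply, Finset.sum_sub_distrib]
      simp only [mul_comm (christoffel G _ i k y), mul_comm (christoffel G _ j k y)]
      ring
    have hdR : ∀ p i j m k, pd p (riemannUp G m i j k) y = (ddA p j i - ddA p i j +
        dA p j * A i + A j * dA p i - dA p i * A j - A i * dA p j) m k := by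
      intro p i j m k
      unfold riemannUp
      have dm : ∀ q, DifferentiableAt ℝ (fun z => christoffel G q i k z * christoffel G m j q z -
          christoffel G q j k z * christoffel G m i q z) y := fun q =>
        ((dΓ _ _ _).fun_mul (dΓ _ _ _)).fun_sub ((dΓ _ _ _).fun_mul (dΓ _ _ _))
      rw [pd_add ((dpΓ _ _ _ _).fun_sub (dpΓ _ _ _ _)) (DifferentiableAt.fun_sum fun q _ => dm q),
        pd_sub (dpΓ _ _ _ _) (dpΓ _ _ _ _), pd_sum fun q _ => dm q]
      have : ∀ q, pd p (fun z => christoffel G q i k z * christoffel G m j q z -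
          christoffel G q j k z * christoffel G m i q z) y =
          dA p j m q * A i q k + A j m q * dA p i q k - dA p i m q * A j q k -
            A i m q * dA p j q k := by
        intro q
        rw [pd_sub ((dΓ _ _ _).fun_mul (dΓ _ _ _)) ((dΓ _ _ _).fun_mul (dΓ _ _ _)),
          pd_mul (dΓ _ _ _) (dΓ _ _ _), pd_mul (dΓ _ _ _) (dΓ _ _ _)]
        simp only [A, dA, Matrix.of_apply]
        ring
      simp only [this, Matrix.sub_apply, Matrix.add_apply, Matrix.mul_apply,
        Finset.sum_sub_distrib, Finset.sum_add_distrib]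
      simp only [ddA, Matrix.of_apply]
      ring
    have hEm : ∀ p i j, E p i j m k = (ddA p j i - ddA p i j +
        dA p j * A i + A j * dA p i - dA p i * A j - A i * dA p j +
        A p * (dA j i - dA i j + A j * A i - A i * A j) -
        (dA j i - dA i j + A j * A i - A i * A j) * A p) m k := by
      intro p i j
      have s1 : ∑ q, christoffel G m p q y * riemannUp G q i j k y =
          (A p * (dA j i - dA i j + A j * A i - A i * A j)) m k := by
        rw [Matrix.mul_apply]
        exact Finset.sum_congr rfl fun q _ => by rw [hR]; rfl
      have s2 : ∑ q, christoffel G q p k y * riemannUp G m i j q y =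
          ((dA j i - dA i j + A j * A i - A i * A j) * A p) m k := by
        rw [Matrix.mul_apply]
        exact Finset.sum_congr rfl fun q _ => by rw [hR, mul_comm]; rfl
      rw [hE]
      simp only []
      rw [s1, s2, hdR, ← Matrix.add_apply, ← Matrix.sub_apply]
    have hdd : ∀ r q p, ddA r q p = ddA q r p := by
      intro r q p
      ext a b
      exact pd_comm h.isOpen hy (hΓ a p b) r q
    rw [hEm, hEm, hEm, ← Matrix.add_apply, ← Matrix.add_apply, hdd j p, hdd p i, hdd i j]
    refine congrFun (congrFun (?_ : _ = (0 : Matrix (Fin n) (Fin n) ℝ)) m) k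
    noncomm_ring
  have hsum : ∑ m, G y l m * E p i j m k + ∑ m, G y l m * E i j p m k +
      ∑ m, G y l m * E j p i m k = 0 := by
    simp only [← Finset.sum_add_distrib, ← mul_add, hcyc, mul_zero, Finset.sum_const_zero]
  rw [hcov i j p, hcov j p i, hcov p i j]
  have hpair : ∀ a b c, ∑ q, christoffel G q a b y * riemann G ![q, c, k, l] y =
      -∑ q, christoffel G q b a y * riemann G ![c, q, k, l] y := by
    intro a b c
    rw [← Finset.sum_neg_distrib]
    refine Finset.sum_congr rfl fun q _ => ?_
    rw [h.christoffel_symm hy q a b, riemann_antisymm_left q c]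
    ring
  linarith [hpair p i j, hpair i j p, hpair j p i]

end IsMetricOn

end Curvature

/-! ### Covariant derivatives of contractions -/

section Contractions

variable {n : ℕ} {G : Coord n → Matrix (Fin n) (Fin n) ℝ} {U : Set (Coord n)} {y : Coord n}

lemma sum_mul_mul_left (X Y : Fin n → ℝ) (r : ℝ) :
    ∑ m, X m * (r * Y m) = r * ∑ m, X m * Y m := by
  rw [Finset.mul_sum]
  exact Finset.sum_congr rfl fun m _ => by ring

lemma sum_mul_mul_right (X Y : Fin n → ℝ) (r : ℝ) :
    ∑ m, X m * (Y m * r) = (∑ m, X m * Y m) * r := by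
  rw [Finset.sum_mul]
  exact Finset.sum_congr rfl fun m _ => by ring

namespace IsMetricOn

lemma covDeriv_one_contract (h : IsMetricOn G U) (hy : y ∈ U) {S : Tensor n 1}
    {F : Fin n → Fin n → Fin n → Coord n → ℝ} (hF : ∀ i a b, ContDiffOn ℝ ∞ (F i a b) U)
    (hS : ∀ i, ∀ z ∈ U, S ![i] z = contract G z fun a b => F i a b z) (i p : Fin n) :
    covDeriv G S ![i, p] y = contract G y fun a b => pd p (F i a b) y -
      ∑ m, christoffel G m p i y * F m a b y -
      ∑ m, christoffel G m p a y * F i m b y - ∑ m, christoffel G m p b y * F i a m y := by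
  rw [covDeriv_one, pd_congr h.isOpen hy (hS i), h.pd_contract hy (hF i)]
  simp only [fun m => hS m y hy]
  simp only [contract_sub, contract_sum, contract_const_mul]
  ring

lemma covDeriv_two_contract (h : IsMetricOn G U) (hy : y ∈ U) {S : Tensor n 2}
    {F : Fin n → Fin n → Fin n → Fin n → Coord n → ℝ}
    (hF : ∀ i j a b, ContDiffOn ℝ ∞ (F i j a b) U)
    (hS : ∀ i j, ∀ z ∈ U, S ![i, j] z = contract G z fun a b => F i j a b z) (i j p : Fin n) :
    covDeriv G S ![i, j, p] y = contract G y fun a b => pd p (F i j a b) y -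
      ∑ m, christoffel G m p i y * F m j a b y - ∑ m, christoffel G m p j y * F i m a b y -
      ∑ m, christoffel G m p a y * F i j m b y - ∑ m, christoffel G m p b y * F i j a m y := by
  rw [covDeriv_two, pd_congr h.isOpen hy (hS i j), h.pd_contract hy (hF i j)]
  simp only [fun m => hS m j y hy, fun m => hS i m y hy]
  simp only [contract_sub, contract_sum, contract_const_mul]
  ring

lemma covDeriv_three_contract (h : IsMetricOn G U) (hy : y ∈ U) {S : Tensor n 3}
    {F : Fin n → Fin n → Fin n → Fin n → Fin n → Coord n → ℝ}
    (hF : ∀ i j k a b, ContDiffOn ℝ ∞ (F i j k a b) U)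
    (hS : ∀ i j k, ∀ z ∈ U, S ![i, j, k] z = contract G z fun a b => F i j k a b z)
    (i j k p : Fin n) :
    covDeriv G S ![i, j, k, p] y = contract G y fun a b => pd p (F i j k a b) y -
      ∑ m, christoffel G m p i y * F m j k a b y - ∑ m, christoffel G m p j y * F i m k a b y -
      ∑ m, christoffel G m p k y * F i j m a b y -
      ∑ m, christoffel G m p a y * F i j k m b y - ∑ m, christoffel G m p b y * F i j k a m y := by
  rw [covDeriv_three, pd_congr h.isOpen hy (hS i j k), h.pd_contract hy (hF i j k)]
  simp only [fun m => hS m j k y hy, fun m => hS i m k y hy, fun m => hS i j m y hy]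
  simp only [contract_sub, contract_sum, contract_const_mul]
  ring

lemma covDeriv_four_contract (h : IsMetricOn G U) (hy : y ∈ U) {S : Tensor n 4}
    {F : Fin n → Fin n → Fin n → Fin n → Fin n → Fin n → Coord n → ℝ}
    (hF : ∀ i j k l a b, ContDiffOn ℝ ∞ (F i j k l a b) U)
    (hS : ∀ i j k l, ∀ z ∈ U, S ![i, j, k, l] z = contract G z fun a b => F i j k l a b z)
    (i j k l p : Fin n) :
    covDeriv G S ![i, j, k, l, p] y = contract G y fun a b => pd p (F i j k l a b) y -
      ∑ m, christoffel G m p i y * F m j k l a b y - ∑ m, christoffel G m p j y * F i m k l a b y -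
      ∑ m, christoffel G m p k y * F i j m l a b y - ∑ m, christoffel G m p l y * F i j k m a b y -
      ∑ m, christoffel G m p a y * F i j k l m b y -
      ∑ m, christoffel G m p b y * F i j k l a m y := by
  rw [covDeriv_four, pd_congr h.isOpen hy (hS i j k l), h.pd_contract hy (hF i j k l)]
  simp only [fun m => hS m j k l y hy, fun m => hS i m k l y hy, fun m => hS i j m l y hy,
    fun m => hS i j k m y hy]
  simp only [contract_sub, contract_sum, contract_const_mul]
  ring

/-! ### Traces of the curvature and the contracted Bianchi identities -/

lemma contract_riemann_first_third (h : IsMetricOn G U) (hy : y ∈ U) (j l : Fin n) :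
    contract G y (fun i k => riemann G ![i, j, k, l] y) = ricci G ![j, l] y := by
  rw [ricci_eq]
  refine contract_congr fun i k => ?_
  rw [riemann_antisymm_left, h.riemann_antisymm_right hy, neg_neg]

lemma covDeriv_riemann_antisymm_left (h : IsMetricOn G U) (hy : y ∈ U) (i j k l p : Fin n) :
    covDeriv G (riemann G) ![i, j, k, l, p] y = -covDeriv G (riemann G) ![j, i, k, l, p] y := by
  rw [covDeriv_perm h.isOpen hy h.smooth_riemann (Equiv.swap 0 1) (-1)
    (fun a z _ => (riemann_antisymm_left (a 1) (a 0) (a 2) (a 3)).trans (neg_one_mul _).symm)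
    ![j, i, k, l, p] ![i, j, k, l, p] (fun s => by fin_cases s <;> rfl) rfl, neg_one_mul]

lemma covDeriv_riemann_antisymm_right (h : IsMetricOn G U) (hy : y ∈ U) (i j k l p : Fin n) :
    covDeriv G (riemann G) ![i, j, k, l, p] y = -covDeriv G (riemann G) ![i, j, l, k, p] y := by
  rw [covDeriv_perm h.isOpen hy h.smooth_riemann (Equiv.swap 2 3) (-1)
    (fun a z hz => (h.riemann_antisymm_right hz (a 0) (a 1) (a 3) (a 2)).trans
      (neg_one_mul _).symm)
    ![i, j, l, k, p] ![i, j, k, l, p] (fun s => by fin_cases s <;> rfl) rfl, neg_one_mul]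

lemma covDeriv_ricci_symm (h : IsMetricOn G U) (hy : y ∈ U) (i j p : Fin n) :
    covDeriv G (ricci G) ![i, j, p] y = covDeriv G (ricci G) ![j, i, p] y := by
  rw [covDeriv_perm h.isOpen hy h.smooth_ricci (Equiv.swap 0 1) 1
    (fun a z hz => (h.ricci_symm hz (a 1) (a 0)).trans (one_mul _).symm)
    ![j, i, p] ![i, j, p] (fun s => by fin_cases s <;> rfl) rfl, one_mul]

lemma covDeriv_ricci_eq (h : IsMetricOn G U) (hy : y ∈ U) (i k p : Fin n) :
    covDeriv G (ricci G) ![i, k, p] y =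
      contract G y fun j l => covDeriv G (riemann G) ![i, j, k, l, p] y := by
  rw [h.covDeriv_two_contract hy (F := fun i k j l => riemann G ![i, j, k, l])
    (fun i k j l => h.smooth_riemann _) (fun i k z _ => ricci_eq i k)]
  refine contract_congr fun j l => ?_
  rw [covDeriv_four]
  ring

lemma pd_scalar (h : IsMetricOn G U) (hy : y ∈ U) (p : Fin n) :
    pd p (scalar G) y = contract G y fun i k => covDeriv G (ricci G) ![i, k, p] y := by
  unfold scalar
  rw [h.pd_contract hy (F := fun z i k => ricci G ![i, k] z) (fun i k => h.smooth_ricci _)]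
  refine contract_congr fun j l => ?_
  rw [covDeriv_two]

/-- The contracted second Bianchi identity `∇^k R_{tijk} = ∇_i R_{tj} - ∇_t R_{ij}`. -/
lemma contract_covDeriv_riemann (h : IsMetricOn G U) (hy : y ∈ U) (t i j : Fin n) :
    contract G y (fun k m => covDeriv G (riemann G) ![t, i, j, k, m] y) =
      covDeriv G (ricci G) ![t, j, i] y - covDeriv G (ricci G) ![i, j, t] y := by
  rw [h.covDeriv_ricci_eq hy, h.covDeriv_ricci_eq hy]
  rw [← h.contract_swap hy (fun a b => covDeriv G (riemann G) ![t, a, j, b, i] y),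
    ← h.contract_swap hy (fun a b => covDeriv G (riemann G) ![i, a, j, b, t] y), ← contract_sub]
  refine contract_congr fun k m => ?_
  have h1 := h.covDeriv_riemann_cyclic hy t i j k m
  have h2 := h.covDeriv_riemann_antisymm_left hy m t j k i
  linarith

/-- The twice contracted second Bianchi identity `∇^k R_{ik} = ½ ∇_i R`. -/
lemma contract_covDeriv_ricci (h : IsMetricOn G U) (hy : y ∈ U) (i : Fin n) :
    contract G y (fun k m => covDeriv G (ricci G) ![i, k, m] y) = 1 / 2 * pd i (scalar G) y := by
  have h1 : contract G y (fun t j => contract G y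
      (fun k m => covDeriv G (riemann G) ![t, i, j, k, m] y)) =
      contract G y (fun k m => covDeriv G (ricci G) ![i, k, m] y) := by
    rw [contract_comm]
    refine contract_congr fun k m => ?_
    rw [h.covDeriv_ricci_eq hy]
    refine contract_congr fun t j => ?_
    rw [h.covDeriv_riemann_antisymm_left hy, h.covDeriv_riemann_antisymm_right hy, neg_neg]
  simp only [h.contract_covDeriv_riemann hy, contract_sub] at h1
  rw [← h.pd_scalar hy] at h1
  have h2 := h.contract_swap hy (fun k m => covDeriv G (ricci G) ![i, k, m] y)
  linarith

end IsMetricOn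

end Contractions

/-! ### The Schouten tensor and the Kulkarni–Nomizu product with the metric -/

/-- The Schouten tensor `A_{ij} = (R_{ij} - R g_{ij} / (2(n-1))) / (n-2)`. -/
noncomputable def schouten {n : ℕ} (G : Coord n → Matrix (Fin n) (Fin n) ℝ) : Tensor n 2 :=
  fun a y => 1 / ((n : ℝ) - 2) *
    (ricci G a y - 1 / (2 * ((n : ℝ) - 1)) * (scalar G y * metricTensor G a y))

/-- The Kulkarni–Nomizu product
`S_{ik} g_{jl} - S_{il} g_{jk} + S_{jl} g_{ik} - S_{jk} g_{il}` of a tensor field of rank 2 with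
the metric. -/
noncomputable def kulkarniNomizu {n : ℕ} (G : Coord n → Matrix (Fin n) (Fin n) ℝ) (S : Tensor n 2) :
    Tensor n 4 :=
  fun a y => S ![a 0, a 2] y * G y (a 1) (a 3) - S ![a 0, a 3] y * G y (a 1) (a 2) +
    S ![a 1, a 3] y * G y (a 0) (a 2) - S ![a 1, a 2] y * G y (a 0) (a 3)

section WeylCotton

variable {n : ℕ} {G : Coord n → Matrix (Fin n) (Fin n) ℝ} {U : Set (Coord n)} {y : Coord n}

lemma natCast_sub_ne_zero (hn : 3 ≤ n) : (n : ℝ) - 1 ≠ 0 ∧ (n : ℝ) - 2 ≠ 0 := by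
  have : (3 : ℝ) ≤ n := by exact_mod_cast hn
  constructor <;> linarith

lemma schouten_eq (i j : Fin n) : schouten G ![i, j] y = 1 / ((n : ℝ) - 2) *
    (ricci G ![i, j] y - 1 / (2 * ((n : ℝ) - 1)) * (scalar G y * G y i j)) := rfl

lemma kulkarniNomizu_eq (S : Tensor n 2) (i j k l : Fin n) :
    kulkarniNomizu G S ![i, j, k, l] y = S ![i, k] y * G y j l - S ![i, l] y * G y j k +
      S ![j, l] y * G y i k - S ![j, k] y * G y i l := rfl

lemma ricci_eq_schouten (hn : 3 ≤ n) (i j : Fin n) : ricci G ![i, j] y =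
    ((n : ℝ) - 2) * schouten G ![i, j] y + 1 / (2 * ((n : ℝ) - 1)) * (scalar G y * G y i j) := by
  obtain ⟨h1, h2⟩ := natCast_sub_ne_zero hn
  rw [schouten_eq]
  field_simp
  ring

/-- The Weyl tensor is the curvature tensor minus the Kulkarni–Nomizu product of the Schouten
tensor with the metric. -/
lemma weyl_eq (hn : 3 ≤ n) (i j k l : Fin n) :
    weyl G ![i, j, k, l] y =
      riemann G ![i, j, k, l] y - kulkarniNomizu G (schouten G) ![i, j, k, l] y := by
  obtain ⟨h1, h2⟩ := natCast_sub_ne_zero hn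
  change riemann G ![i, j, k, l] y - 1 / ((n : ℝ) - 2) *
        (ricci G ![i, k] y * G y j l - ricci G ![i, l] y * G y j k +
          ricci G ![j, l] y * G y i k - ricci G ![j, k] y * G y i l) +
      scalar G y / (((n : ℝ) - 1) * ((n : ℝ) - 2)) * (G y i k * G y j l - G y i l * G y j k) = _
  simp only [kulkarniNomizu_eq, schouten_eq]
  field_simp
  ring

lemma weyl_antisymm_left (hn : 3 ≤ n) (i j k l : Fin n) :
    weyl G ![i, j, k, l] y = -weyl G ![j, i, k, l] y := by
  rw [weyl_eq hn, weyl_eq hn, riemann_antisymm_left, kulkarniNomizu_eq,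
    kulkarniNomizu_eq]
  ring

namespace IsMetricOn

lemma smooth_schouten (h : IsMetricOn G U) : SmoothTensorOn (schouten G) U := fun _ =>
  contDiffOn_const.mul ((h.smooth_ricci _).sub
    (contDiffOn_const.mul (h.contDiffOn_scalar.mul (h.smooth_metricTensor _))))

lemma smooth_kulkarniNomizu (h : IsMetricOn G U) {S : Tensor n 2} (hS : SmoothTensorOn S U) :
    SmoothTensorOn (kulkarniNomizu G S) U := fun _ =>
  ((((hS _).mul (h.contDiffOn _ _)).sub ((hS _).mul (h.contDiffOn _ _))).add
    ((hS _).mul (h.contDiffOn _ _))).sub ((hS _).mul (h.contDiffOn _ _))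

lemma schouten_symm (h : IsMetricOn G U) (hy : y ∈ U) (i j : Fin n) :
    schouten G ![i, j] y = schouten G ![j, i] y := by
  rw [schouten_eq, schouten_eq, h.ricci_symm hy, h.symm y hy]

lemma covDeriv_mul_metricTensor (h : IsMetricOn G U) (hy : y ∈ U) {u : Coord n → ℝ}
    (hu : ContDiffOn ℝ ∞ u U) (i j p : Fin n) :
    covDeriv G (fun a z => u z * metricTensor G a z) ![i, j, p] y = pd p u y * G y i j := by
  have e := h.covDeriv_metricTensor hy ![i, j, p]
  rw [covDeriv_two] at e ⊢
  rw [pd_mul (differentiableAt_of_contDiffOn h.isOpen hy hu)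
    (differentiableAt_of_contDiffOn h.isOpen hy (h.smooth_metricTensor _))]
  simp only [sum_mul_mul_left]
  change pd p u y * metricTensor G ![i, j] y + _ - _ - _ = pd p u y * metricTensor G ![i, j] y
  linear_combination u y * e

lemma covDeriv_schouten (h : IsMetricOn G U) (hy : y ∈ U) (i j p : Fin n) :
    covDeriv G (schouten G) ![i, j, p] y = 1 / ((n : ℝ) - 2) *
      (covDeriv G (ricci G) ![i, j, p] y -
        1 / (2 * ((n : ℝ) - 1)) * (pd p (scalar G) y * G y i j)) := by
  have hs : SmoothTensorOn (fun a z => scalar G z * metricTensor G a z) U := fun a =>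
    h.contDiffOn_scalar.mul (h.smooth_metricTensor a)
  have hs' : SmoothTensorOn
      (fun a z => 1 / (2 * ((n : ℝ) - 1)) * (scalar G z * metricTensor G a z)) U := fun a =>
    contDiffOn_const.mul (hs a)
  unfold schouten
  rw [covDeriv_const_mul h.isOpen hy (T := fun a z => ricci G a z -
      1 / (2 * ((n : ℝ) - 1)) * (scalar G z * metricTensor G a z))
      (fun a => (h.smooth_ricci a).sub (hs' a)),
    covDeriv_sub h.isOpen hy h.smooth_ricci hs', covDeriv_const_mul h.isOpen hy hs,
    h.covDeriv_mul_metricTensor hy h.contDiffOn_scalar]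

lemma covDeriv_ricci_eq_schouten (h : IsMetricOn G U) (hn : 3 ≤ n) (hy : y ∈ U) (i j p : Fin n) :
    covDeriv G (ricci G) ![i, j, p] y = ((n : ℝ) - 2) * covDeriv G (schouten G) ![i, j, p] y +
      1 / (2 * ((n : ℝ) - 1)) * (pd p (scalar G) y * G y i j) := by
  obtain ⟨h1, h2⟩ := natCast_sub_ne_zero hn
  rw [h.covDeriv_schouten hy]
  field_simp
  ring

lemma covDeriv_schouten_symm (h : IsMetricOn G U) (hy : y ∈ U) (i j p : Fin n) :
    covDeriv G (schouten G) ![i, j, p] y = covDeriv G (schouten G) ![j, i, p] y := by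
  rw [h.covDeriv_schouten hy, h.covDeriv_schouten hy, h.covDeriv_ricci_symm hy, h.symm y hy]

lemma contract_schouten (h : IsMetricOn G U) (hn : 3 ≤ n) (hy : y ∈ U) :
    contract G y (fun i j => schouten G ![i, j] y) = 1 / (2 * ((n : ℝ) - 1)) * scalar G y := by
  obtain ⟨h1, h2⟩ := natCast_sub_ne_zero hn
  simp only [schouten_eq, contract_const_mul, contract_sub, h.contract_mul_metric_self hy]
  rw [← scalar]
  field_simp
  ring

lemma contract_covDeriv_schouten_left (h : IsMetricOn G U) (hn : 3 ≤ n) (hy : y ∈ U)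
    (p : Fin n) : contract G y (fun i j => covDeriv G (schouten G) ![i, j, p] y) =
      1 / (2 * ((n : ℝ) - 1)) * pd p (scalar G) y := by
  obtain ⟨h1, h2⟩ := natCast_sub_ne_zero hn
  simp only [h.covDeriv_schouten hy, contract_const_mul, contract_sub, h.contract_mul_metric_self hy]
  rw [← h.pd_scalar hy]
  field_simp
  ring

/-- The divergence of the Schouten tensor is the differential of its trace. -/
lemma contract_covDeriv_schouten (h : IsMetricOn G U) (hn : 3 ≤ n) (hy : y ∈ U) (i : Fin n) :
    contract G y (fun k p => covDeriv G (schouten G) ![i, k, p] y) =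
      1 / (2 * ((n : ℝ) - 1)) * pd i (scalar G) y := by
  obtain ⟨h1, h2⟩ := natCast_sub_ne_zero hn
  simp only [h.covDeriv_schouten hy, contract_const_mul, contract_sub,
    h.contract_covDeriv_ricci hy, h.contract_metric_left' hy]
  field_simp
  ring

lemma covDeriv_kulkarniNomizu (h : IsMetricOn G U) (hy : y ∈ U) {S : Tensor n 2}
    (hS : SmoothTensorOn S U) (i j k l p : Fin n) :
    covDeriv G (kulkarniNomizu G S) ![i, j, k, l, p] y =
      covDeriv G S ![i, k, p] y * G y j l - covDeriv G S ![i, l, p] y * G y j k +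
      covDeriv G S ![j, l, p] y * G y i k - covDeriv G S ![j, k, p] y * G y i l := by
  have dG := fun a b => differentiableAt_of_contDiffOn h.isOpen hy (h.contDiffOn a b)
  have dS := fun a => differentiableAt_of_contDiffOn h.isOpen hy (hS a)
  have d := fun (a b c d : Fin n) => (dS ![a, b]).fun_mul (dG c d)
  have e : pd p (kulkarniNomizu G S ![i, j, k, l]) y =
      (pd p (S ![i, k]) y * G y j l + S ![i, k] y * pd p (fun z => G z j l) y) -
      (pd p (S ![i, l]) y * G y j k + S ![i, l] y * pd p (fun z => G z j k) y) +
      (pd p (S ![j, l]) y * G y i k + S ![j, l] y * pd p (fun z => G z i k) y) -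
      (pd p (S ![j, k]) y * G y i l + S ![j, k] y * pd p (fun z => G z i l) y) := by
    change pd p (fun z => S ![i, k] z * G z j l - S ![i, l] z * G z j k +
      S ![j, l] z * G z i k - S ![j, k] z * G z i l) y = _
    rw [pd_sub (((d _ _ _ _).fun_sub (d _ _ _ _)).fun_add (d _ _ _ _)) (d _ _ _ _),
      pd_add ((d _ _ _ _).fun_sub (d _ _ _ _)) (d _ _ _ _), pd_sub (d _ _ _ _) (d _ _ _ _),
      pd_mul (dS _) (dG _ _), pd_mul (dS _) (dG _ _), pd_mul (dS _) (dG _ _),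
      pd_mul (dS _) (dG _ _)]
  rw [covDeriv_four, e]
  simp only [h.pd_metric hy, covDeriv_two, kulkarniNomizu_eq, mul_add, mul_sub,
    Finset.sum_add_distrib, Finset.sum_sub_distrib, sum_mul_mul_left, sum_mul_mul_right]
  ring

/-! ### The Weyl tensor -/

lemma smooth_weyl (h : IsMetricOn G U) : SmoothTensorOn (weyl G) U := fun _ => by
  have hR := h.smooth_ricci
  have hg := h.contDiffOn
  exact ((h.smooth_riemann _).sub (contDiffOn_const.mul (((((hR _).mul (hg _ _)).sub
    ((hR _).mul (hg _ _))).add ((hR _).mul (hg _ _))).sub ((hR _).mul (hg _ _))))).add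
    ((h.contDiffOn_scalar.div_const _).mul (((hg _ _).mul (hg _ _)).sub ((hg _ _).mul (hg _ _))))

lemma weyl_antisymm_right (h : IsMetricOn G U) (hn : 3 ≤ n) (hy : y ∈ U) (i j k l : Fin n) :
    weyl G ![i, j, k, l] y = -weyl G ![i, j, l, k] y := by
  rw [weyl_eq hn, weyl_eq hn, h.riemann_antisymm_right hy, kulkarniNomizu_eq,
    kulkarniNomizu_eq]
  ring

lemma weyl_pair_symm (h : IsMetricOn G U) (hn : 3 ≤ n) (hy : y ∈ U) (i j k l : Fin n) :
    weyl G ![i, j, k, l] y = weyl G ![k, l, i, j] y := by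
  rw [weyl_eq hn, weyl_eq hn, h.riemann_pair_symm hy, kulkarniNomizu_eq,
    kulkarniNomizu_eq, h.schouten_symm hy k i, h.schouten_symm hy k j, h.schouten_symm hy l j,
    h.schouten_symm hy l i, h.symm y hy k i, h.symm y hy k j, h.symm y hy l j,
    h.symm y hy l i]
  ring

/-- The Weyl tensor is totally trace free; by its symmetries one trace suffices. -/
lemma contract_weyl (h : IsMetricOn G U) (hn : 3 ≤ n) (hy : y ∈ U) (i k : Fin n) :
    contract G y (fun j l => weyl G ![i, j, k, l] y) = 0 := by
  obtain ⟨h1, h2⟩ := natCast_sub_ne_zero hn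
  simp only [weyl_eq hn, kulkarniNomizu_eq, contract_sub, contract_add, contract_mul_const,
    h.contract_mul_metric_self hy, h.contract_schouten hn hy]
  rw [← ricci_eq, h.contract_metric_left hy k (fun l => schouten G ![i, l] y),
    h.contract_metric' hy i (fun j => schouten G ![j, k] y), ricci_eq_schouten hn]
  field_simp
  ring

lemma contract_weyl_second_third (h : IsMetricOn G U) (hn : 3 ≤ n) (hy : y ∈ U) (i l : Fin n) :
    contract G y (fun j k => weyl G ![i, j, k, l] y) = 0 := by
  simp only [fun j k => h.weyl_antisymm_right hn hy i j k l, contract_neg, h.contract_weyl hn hy,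
    neg_zero]

lemma covDeriv_weyl (h : IsMetricOn G U) (hn : 3 ≤ n) (hy : y ∈ U) (i j k l p : Fin n) :
    covDeriv G (weyl G) ![i, j, k, l, p] y = covDeriv G (riemann G) ![i, j, k, l, p] y -
      (covDeriv G (schouten G) ![i, k, p] y * G y j l -
        covDeriv G (schouten G) ![i, l, p] y * G y j k +
        covDeriv G (schouten G) ![j, l, p] y * G y i k -
        covDeriv G (schouten G) ![j, k, p] y * G y i l) := by
  rw [← h.covDeriv_kulkarniNomizu hy h.smooth_schouten,
    ← covDeriv_sub h.isOpen hy h.smooth_riemann (h.smooth_kulkarniNomizu h.smooth_schouten)]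
  exact covDeriv_congr h.isOpen hy
    (fun a z hz => weyl_eq hn (a 0) (a 1) (a 2) (a 3)) _

lemma covDeriv_weyl_antisymm_right (h : IsMetricOn G U) (hn : 3 ≤ n) (hy : y ∈ U)
    (i j k l p : Fin n) :
    covDeriv G (weyl G) ![i, j, k, l, p] y = -covDeriv G (weyl G) ![i, j, l, k, p] y := by
  rw [h.covDeriv_weyl hn hy, h.covDeriv_weyl hn hy, h.covDeriv_riemann_antisymm_right hy]
  ring

/-! ### The Cotton tensor -/

lemma cotton_eq (h : IsMetricOn G U) (hn : 3 ≤ n) (hy : y ∈ U) (i j k : Fin n) :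
    cotton G ![i, j, k] y = ((n : ℝ) - 2) *
      (covDeriv G (schouten G) ![i, j, k] y - covDeriv G (schouten G) ![i, k, j] y) := by
  obtain ⟨h1, h2⟩ := natCast_sub_ne_zero hn
  change covDeriv G (ricci G) ![i, j, k] y - covDeriv G (ricci G) ![i, k, j] y -
      1 / (2 * ((n : ℝ) - 1)) * (pd k (scalar G) y * G y i j - pd j (scalar G) y * G y i k) = _
  rw [h.covDeriv_ricci_eq_schouten hn hy, h.covDeriv_ricci_eq_schouten hn hy]
  ring

lemma smooth_cotton (h : IsMetricOn G U) : SmoothTensorOn (cotton G) U := fun _ => by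
  have hR := h.smooth_covDeriv h.smooth_ricci
  have hg := h.contDiffOn
  have hs := contDiffOn_pd h.isOpen h.contDiffOn_scalar
  exact ((hR _).sub (hR _)).sub (contDiffOn_const.mul (((hs _).mul (hg _ _)).sub
    ((hs _).mul (hg _ _))))

lemma cotton_antisymm (h : IsMetricOn G U) (hn : 3 ≤ n) (hy : y ∈ U) (i j k : Fin n) :
    cotton G ![i, j, k] y = -cotton G ![i, k, j] y := by
  rw [h.cotton_eq hn hy, h.cotton_eq hn hy]
  ring

/-- The Cotton tensor is trace free. -/
lemma contract_cotton (h : IsMetricOn G U) (hn : 3 ≤ n) (hy : y ∈ U) (k : Fin n) :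
    contract G y (fun i j => cotton G ![i, j, k] y) = 0 := by
  simp only [h.cotton_eq hn hy, contract_const_mul, contract_sub,
    h.contract_covDeriv_schouten_left hn hy]
  simp only [fun i j => h.covDeriv_schouten_symm hy i k j]
  have e := h.contract_covDeriv_schouten hn hy k
  rw [e]
  ring

/-- The divergence of the Weyl tensor. -/
lemma contract_covDeriv_weyl (h : IsMetricOn G U) (hn : 3 ≤ n) (hy : y ∈ U) (t i j : Fin n) :
    contract G y (fun k p => covDeriv G (weyl G) ![t, i, j, k, p] y) =
      -(((n : ℝ) - 3) / ((n : ℝ) - 2)) * cotton G ![j, i, t] y := by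
  obtain ⟨h1, h2⟩ := natCast_sub_ne_zero hn
  simp only [h.covDeriv_weyl hn hy, contract_sub, contract_add, contract_mul_const,
    h.contract_covDeriv_riemann hy, h.contract_covDeriv_schouten hn hy]
  rw [h.contract_metric_left' hy i (fun p => covDeriv G (schouten G) ![t, j, p] y),
    h.contract_metric_left' hy t (fun p => covDeriv G (schouten G) ![i, j, p] y),
    h.covDeriv_ricci_eq_schouten hn hy, h.covDeriv_ricci_eq_schouten hn hy, h.cotton_eq hn hy,
    h.covDeriv_schouten_symm hy j i t, h.covDeriv_schouten_symm hy j t i]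
  field_simp
  ring

lemma covDeriv_cotton (h : IsMetricOn G U) (hn : 3 ≤ n) (hy : y ∈ U) (i j k p : Fin n) :
    covDeriv G (cotton G) ![i, j, k, p] y = ((n : ℝ) - 2) *
      (covDeriv G (covDeriv G (schouten G)) ![i, j, k, p] y -
        covDeriv G (covDeriv G (schouten G)) ![i, k, j, p] y) := by
  have hA := h.smooth_covDeriv h.smooth_schouten
  let σ : Equiv.Perm (Fin 3) := Equiv.swap 1 2
  have hAσ : SmoothTensorOn (fun a => covDeriv G (schouten G) fun s => a (σ s)) U := fun a => hA _
  rw [← covDeriv_comp_perm (covDeriv G (schouten G)) σ ![i, j, k, p] ![i, k, j, p]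
    (fun s => by fin_cases s <;> rfl) rfl, ← covDeriv_sub h.isOpen hy hA hAσ,
    ← covDeriv_const_mul h.isOpen hy (fun a => (hA a).sub (hAσ a))]
  refine covDeriv_congr h.isOpen hy (fun a z hz => ?_) _
  have ha : a = ![a 0, a 1, a 2] := by ext s; fin_cases s <;> rfl
  have ha' : (fun s => a (σ s)) = ![a 0, a 2, a 1] := by ext s; fin_cases s <;> rfl
  rw [ha', ha]
  exact h.cotton_eq hn hz (a 0) (a 1) (a 2)

lemma covDeriv_cotton_antisymm (h : IsMetricOn G U) (hn : 3 ≤ n) (hy : y ∈ U) (i j k p : Fin n) :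
    covDeriv G (cotton G) ![i, j, k, p] y = -covDeriv G (cotton G) ![i, k, j, p] y := by
  rw [h.covDeriv_cotton hn hy, h.covDeriv_cotton hn hy]
  ring

lemma covDeriv_cotton_cyclic (h : IsMetricOn G U) (hn : 3 ≤ n) (hy : y ∈ U) (i j k p : Fin n) :
    covDeriv G (cotton G) ![i, j, k, p] y + covDeriv G (cotton G) ![j, k, i, p] y +
      covDeriv G (cotton G) ![k, i, j, p] y = 0 := by
  have hs : ∀ i j k, covDeriv G (covDeriv G (schouten G)) ![i, j, k, p] y =
      covDeriv G (covDeriv G (schouten G)) ![j, i, k, p] y := fun i j k => by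
    rw [covDeriv_perm h.isOpen hy (h.smooth_covDeriv h.smooth_schouten) (Equiv.swap 0 1) 1
      (fun a z hz => ?_) ![j, i, k, p] ![i, j, k, p] (fun s => by fin_cases s <;> rfl) rfl,
      one_mul]
    have ha : a = ![a 0, a 1, a 2] := by ext s; fin_cases s <;> rfl
    have ha' : (fun s => a (Equiv.swap (0 : Fin 3) 1 s)) = ![a 1, a 0, a 2] := by
      ext s; fin_cases s <;> rfl
    rw [one_mul, ha', h.covDeriv_schouten_symm hz, ← ha]
  rw [h.covDeriv_cotton hn hy, h.covDeriv_cotton hn hy, h.covDeriv_cotton hn hy, hs j i k,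
    hs k j i, hs k i j]
  ring

/-- The Cotton tensor is divergence free in its first index. -/
lemma contract_covDeriv_cotton_first (h : IsMetricOn G U) (hn : 3 ≤ n) (hy : y ∈ U)
    (j k : Fin n) : contract G y (fun i p => covDeriv G (cotton G) ![i, j, k, p] y) = 0 := by
  obtain ⟨h1, h2⟩ := natCast_sub_ne_zero hn
  -- the commutator terms
  have hQ : ∀ j k, contract G y (fun i p =>
      covDeriv G (covDeriv G (schouten G)) ![i, j, k, p] y) =
      1 / (2 * ((n : ℝ) - 1)) * (pd k (pd j (scalar G)) y -
        ∑ m, christoffel G m k j y * pd m (scalar G) y) +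
      contract G y (fun l m => ricci G ![k, l] y * schouten G ![m, j] y) -
      contract G y (fun i p => contract G y (fun l m =>
        riemann G ![k, p, j, l] y * schouten G ![i, m] y)) := by
    intro j k
    have hdiv : contract G y (fun i p =>
        covDeriv G (covDeriv G (schouten G)) ![i, j, p, k] y) =
        1 / (2 * ((n : ℝ) - 1)) * (pd k (pd j (scalar G)) y -
        ∑ m, christoffel G m k j y * pd m (scalar G) y) := by
      have e1 : covDeriv G
          (fun a z => 1 / (2 * ((n : ℝ) - 1)) * differential (scalar G) a z) ![j, k] y = _ :=
        h.covDeriv_one_contract hy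
          (F := fun j i p => covDeriv G (schouten G) ![i, j, p])
          (fun j i p => h.smooth_covDeriv h.smooth_schouten _) (fun j z hz => by
            simp only [fun i p => h.covDeriv_schouten_symm hz i j p]
            exact (h.contract_covDeriv_schouten hn hz j).symm) j k
      rw [covDeriv_const_mul h.isOpen hy (T := differential (scalar G))
        (fun a => contDiffOn_pd h.isOpen h.contDiffOn_scalar _), covDeriv_one] at e1
      refine Eq.trans ?_ e1.symm
      refine contract_congr fun i p => ?_
      rw [covDeriv_three]
      ring
    have hcomm : ∀ i p, covDeriv G (covDeriv G (schouten G)) ![i, j, k, p] y =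
        covDeriv G (covDeriv G (schouten G)) ![i, j, p, k] y -
        contract G y (fun l m => riemann G ![k, p, i, l] y * schouten G ![m, j] y) -
        contract G y (fun l m => riemann G ![k, p, j, l] y * schouten G ![i, m] y) := by
      intro i p
      have := h.covDeriv_comm_two hy h.smooth_schouten i j k p
      rw [h.sum_riemannUp_mul hy, h.sum_riemannUp_mul hy] at this
      linarith
    simp only [hcomm, contract_sub, hdiv]
    rw [contract_comm (fun i p l m => riemann G ![k, p, i, l] y * schouten G ![m, j] y)]
    have e2 : ∀ l, contract G y (fun i p => riemann G ![k, p, i, l] y) = -ricci G ![k, l] y := by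
      intro l
      rw [h.contract_swap hy (fun p i => riemann G ![k, p, i, l] y), ricci_eq, ← contract_neg]
      refine contract_congr fun p i => ?_
      rw [h.riemann_antisymm_right hy]
    simp only [contract_mul_const, e2, neg_mul, contract_neg]
    ring
  have hRicA : contract G y (fun l m => ricci G ![k, l] y * schouten G ![m, j] y) =
      contract G y (fun l m => ricci G ![j, l] y * schouten G ![m, k] y) := by
    simp only [schouten_eq, mul_sub, mul_left_comm (ricci G _ y), contract_sub, contract_const_mul,
      h.contract_metric hy]
    rw [h.ricci_symm hy k j, ← h.contract_swap hy (fun l m => ricci G ![j, l] y * ricci G ![m, k] y)]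
    congr 3
    funext l m
    rw [h.ricci_symm hy k l, h.ricci_symm hy m j]
    ring
  have hRiemA : contract G y (fun i p => contract G y (fun l m =>
        riemann G ![k, p, j, l] y * schouten G ![i, m] y)) =
      contract G y (fun i p => contract G y (fun l m =>
        riemann G ![j, p, k, l] y * schouten G ![i, m] y)) := by
    rw [contract_comm, ← h.contract_swap hy]
    refine contract_congr fun i p => ?_
    rw [← h.contract_swap hy]
    refine contract_congr fun l m => ?_
    rw [h.riemann_pair_symm hy, h.schouten_symm hy]
  have hΓ : ∀ m, christoffel G m k j y = christoffel G m j k y := fun m =>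
    h.christoffel_symm hy m k j
  simp only [h.covDeriv_cotton hn hy, contract_const_mul, contract_sub, hQ, hRicA, hRiemA, hΓ,
    pd_comm h.isOpen hy h.contDiffOn_scalar k j]
  ring

/-- The divergence of the Cotton tensor in its last index is symmetric. -/
lemma contract_covDeriv_cotton_symm (h : IsMetricOn G U) (hn : 3 ≤ n) (hy : y ∈ U)
    (i j : Fin n) : contract G y (fun k p => covDeriv G (cotton G) ![i, j, k, p] y) =
      contract G y (fun k p => covDeriv G (cotton G) ![j, i, k, p] y) := by
  have e : ∀ k p, covDeriv G (cotton G) ![i, j, k, p] y =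
      covDeriv G (cotton G) ![j, i, k, p] y - covDeriv G (cotton G) ![k, i, j, p] y := by
    intro k p
    linarith [h.covDeriv_cotton_cyclic hn hy i j k p, h.covDeriv_cotton_antisymm hn hy j k i p]
  simp only [e, contract_sub, h.contract_covDeriv_cotton_first hn hy, sub_zero]

end IsMetricOn

end WeylCotton

/-! ### Contractions of the Cotton tensor with curvature tensors -/

section CottonContractions

variable {n : ℕ} {G : Coord n → Matrix (Fin n) (Fin n) ℝ} {U : Set (Coord n)} {y : Coord n}

/-- In a full contraction against an antisymmetric tensor only the antisymmetric part counts. -/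
lemma contract_mul_antisymm (S T : Fin n → Fin n → ℝ)
    (hT : ∀ b d, T b d = -T d b) :
    contract G y (fun a b => contract G y fun c d => S a c * T b d) =
      1 / 2 * contract G y (fun a b => contract G y fun c d => (S a c - S c a) * T b d) := by
  have e : contract G y (fun a b => contract G y fun c d => S c a * T b d) =
      -contract G y (fun a b => contract G y fun c d => S a c * T b d) := by
    rw [contract_comm, ← contract_neg]
    refine contract_congr fun a b => ?_
    rw [← contract_neg]
    refine contract_congr fun c d => ?_
    rw [hT]
    ring
  simp only [sub_mul, contract_sub, e]
  ring

lemma contract_symm_mul_antisymm (S T : Fin n → Fin n → ℝ)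
    (hS : ∀ a c, S a c = S c a) (hT : ∀ b d, T b d = -T d b) :
    contract G y (fun a b => contract G y fun c d => S a c * T b d) = 0 := by
  rw [contract_mul_antisymm S T hT]
  simp only [fun a c => sub_eq_zero.2 (hS a c), zero_mul, contract_zero, mul_zero]

namespace IsMetricOn

/-- The trace of the Cotton tensor over its first and last index. -/
lemma contract_cotton_first_last (h : IsMetricOn G U) (hn : 3 ≤ n) (hy : y ∈ U) (j : Fin n) :
    contract G y (fun i k => cotton G ![i, j, k] y) = 0 := by
  simp only [fun i k => h.cotton_antisymm hn hy i j k, contract_neg, h.contract_cotton hn hy,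
    neg_zero]

/-- `A^{kt} C_{kti} = R^{kt} C_{kti} / (n-2)` for the Schouten tensor `A`. -/
lemma contract_schouten_mul_cotton (h : IsMetricOn G U) (hn : 3 ≤ n) (hy : y ∈ U) (i : Fin n) :
    contract G y (fun k k' => contract G y fun t t' =>
      schouten G ![k, t] y * cotton G ![k', t', i] y) = 1 / ((n : ℝ) - 2) *
    contract G y (fun k k' => contract G y fun t t' =>
      ricci G ![k, t] y * cotton G ![k', t', i] y) := by
  have e : ∀ k k' t t', schouten G ![k, t] y * cotton G ![k', t', i] y = 1 / ((n : ℝ) - 2) *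
      (ricci G ![k, t] y * cotton G ![k', t', i] y - 1 / (2 * ((n : ℝ) - 1)) * scalar G y *
        (cotton G ![k', t', i] y * G y t k)) := fun k k' t t' => by
    rw [schouten_eq, h.symm y hy t k]
    ring
  simp only [e, contract_const_mul, contract_sub,
    fun k k' => h.contract_metric_left hy k (fun t' => cotton G ![k', t', i] y)]
  rw [h.contract_swap hy (fun k k' => cotton G ![k, k', i] y), h.contract_cotton hn hy]
  ring

/-- `A^{tl} C_{lit} = -R^{kt} C_{kti} / (n-2)` for the Schouten tensor `A`. -/
lemma contract_schouten_mul_cotton' (h : IsMetricOn G U) (hn : 3 ≤ n) (hy : y ∈ U) (i : Fin n) :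
    contract G y (fun t t' => contract G y fun l m =>
      schouten G ![t', l] y * cotton G ![m, i, t] y) = -(1 / ((n : ℝ) - 2) *
    contract G y (fun k k' => contract G y fun t t' =>
      ricci G ![k, t] y * cotton G ![k', t', i] y)) := by
  rw [← h.contract_schouten_mul_cotton hn hy, contract_comm, ← contract_neg]
  refine contract_congr fun l m => ?_
  rw [← h.contract_swap hy, ← contract_neg]
  refine contract_congr fun t t' => ?_
  rw [h.cotton_antisymm hn hy m i t', h.schouten_symm hy t l]
  ring

/-- The part of `R_{tkim} C_{mkt}` coming from the Schouten tensor: of the four terms of the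
Kulkarni–Nomizu product two are traces of `C`, and the other two agree. -/
lemma contract_kulkarniNomizu_mul_cotton (h : IsMetricOn G U) (hn : 3 ≤ n) (hy : y ∈ U)
    (i : Fin n) :
    contract G y (fun k p => contract G y fun t t' => contract G y fun l m =>
      kulkarniNomizu G (schouten G) ![t', p, i, l] y * cotton G ![m, k, t] y) =
    2 / ((n : ℝ) - 2) * contract G y (fun k k' => contract G y fun t t' =>
      ricci G ![k, t] y * cotton G ![k', t', i] y) := by
  have e : ∀ k p t t' l m, kulkarniNomizu G (schouten G) ![t', p, i, l] y * cotton G ![m, k, t] y =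
      schouten G ![t', i] y * (cotton G ![m, k, t] y * G y l p) -
      schouten G ![t', l] y * cotton G ![m, k, t] y * G y p i +
      schouten G ![p, l] y * cotton G ![m, k, t] y * G y t' i -
      schouten G ![p, i] y * (cotton G ![m, k, t] y * G y l t') := fun k p t t' l m => by
    rw [kulkarniNomizu_eq, h.symm y hy p l, h.symm y hy t' l]
    ring
  have e1 : ∀ k p t, contract G y (fun l m => cotton G ![m, k, t] y * G y l p) =
      cotton G ![p, k, t] y := fun k p t =>
    h.contract_metric_left hy p fun m => cotton G ![m, k, t] y
  have e2 : contract G y (fun k p => contract G y fun t t' =>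
      schouten G ![t', i] y * cotton G ![p, k, t] y) = 0 := by
    rw [contract_comm]
    simp only [contract_const_mul]
    simp only [fun t => (h.contract_swap hy fun k p => cotton G ![k, p, t] y).trans
      (h.contract_cotton hn hy t), mul_zero, contract_zero]
  have e3 : ∀ k, contract G y (fun t t' => cotton G ![t', k, t] y) = 0 := fun k =>
    (h.contract_swap hy fun t t' => cotton G ![t, k, t'] y).trans
      (h.contract_cotton_first_last hn hy k)
  have e4 : contract G y (fun k p => contract G y (fun t t' => contract G y fun l m =>
      schouten G ![t', l] y * cotton G ![m, k, t] y) * G y p i) =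
      contract G y (fun t t' => contract G y fun l m =>
        schouten G ![t', l] y * cotton G ![m, i, t] y) :=
    h.contract_metric hy i fun k => contract G y (fun t t' => contract G y fun l m =>
      schouten G ![t', l] y * cotton G ![m, k, t] y)
  have e5 : ∀ k p, contract G y (fun t t' => contract G y (fun l m =>
      schouten G ![p, l] y * cotton G ![m, k, t] y) * G y t' i) =
      contract G y (fun l m => schouten G ![p, l] y * cotton G ![m, k, i] y) := fun k p =>
    h.contract_metric hy i fun t => contract G y fun l m =>
      schouten G ![p, l] y * cotton G ![m, k, t] y
  have e6 : contract G y (fun k p => contract G y fun l m =>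
      schouten G ![p, l] y * cotton G ![m, k, i] y) = 1 / ((n : ℝ) - 2) *
      contract G y (fun k k' => contract G y fun t t' =>
      ricci G ![k, t] y * cotton G ![k', t', i] y) := by
    rw [← h.contract_schouten_mul_cotton hn hy, contract_comm]
    refine contract_congr fun l m => ?_
    rw [← h.contract_swap hy]
    refine contract_congr fun t t' => ?_
    rw [h.schouten_symm hy]
  have e7 : ∀ k p, contract G y (fun t t' => contract G y fun l m =>
      schouten G ![p, i] y * (cotton G ![m, k, t] y * G y l t')) = 0 := fun k p => by
    simp only [contract_const_mul,
      fun t t' => h.contract_metric_left hy t' fun m => cotton G ![m, k, t] y, e3, mul_zero]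
  simp only [e, contract_sub, contract_add, e7]
  simp only [contract_const_mul, contract_mul_const, e1, e2, e4, e5, e6, contract_zero]
  rw [h.contract_schouten_mul_cotton' hn hy]
  ring

lemma contract_riemann_second_third (h : IsMetricOn G U) (hy : y ∈ U) (i l : Fin n) :
    contract G y (fun j k => riemann G ![i, j, k, l] y) = -ricci G ![i, l] y := by
  rw [ricci_eq, ← contract_neg]
  exact contract_congr fun j k => h.riemann_antisymm_right hy i j k l

/-- The double divergence `C_{ikt,tk}`: by antisymmetry of `C` in its last two indices it is half
a commutator of covariant derivatives. -/
lemma contract_covDeriv_covDeriv_cotton (h : IsMetricOn G U) (hn : 3 ≤ n) (hy : y ∈ U)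
    (i : Fin n) :
    contract G y (fun k p => contract G y fun t t' =>
      covDeriv G (covDeriv G (cotton G)) ![i, k, t, t', p] y) =
    -(1 / 2 * contract G y (fun k p => contract G y fun t t' => contract G y fun l m =>
      weyl G ![t', p, i, l] y * cotton G ![m, k, t] y)) -
    1 / ((n : ℝ) - 2) * contract G y (fun k k' => contract G y fun t t' =>
      ricci G ![k, t] y * cotton G ![k', t', i] y) := by
  have hanti : ∀ k t t' p, covDeriv G (covDeriv G (cotton G)) ![i, k, t, t', p] y =
      -covDeriv G (covDeriv G (cotton G)) ![i, t, k, t', p] y := fun k t t' p => by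
    rw [covDeriv_perm h.isOpen hy (h.smooth_covDeriv h.smooth_cotton) (Equiv.swap 1 2) (-1)
      (fun a z hz => ?_) ![i, t, k, t', p] ![i, k, t, t', p] (fun s => by fin_cases s <;> rfl) rfl,
      neg_one_mul]
    have ha : a = ![a 0, a 1, a 2, a 3] := by ext s; fin_cases s <;> rfl
    have ha' : (fun s => a (Equiv.swap (1 : Fin 4) 2 s)) = ![a 0, a 2, a 1, a 3] := by
      ext s; fin_cases s <;> rfl
    rw [neg_one_mul, ha', h.covDeriv_cotton_antisymm hn hz, ← ha]
  have hswap : contract G y (fun k p => contract G y fun t t' =>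
      covDeriv G (covDeriv G (cotton G)) ![i, k, t, t', p] y) =
      -contract G y (fun k p => contract G y fun t t' =>
      covDeriv G (covDeriv G (cotton G)) ![i, k, t, p, t'] y) := by
    rw [contract_comm, ← contract_neg]
    refine contract_congr fun t t' => ?_
    rw [← contract_neg]
    exact contract_congr fun k p => hanti k t t' p
  have hcomm : ∀ k p t t', covDeriv G (covDeriv G (cotton G)) ![i, k, t, t', p] y -
      covDeriv G (covDeriv G (cotton G)) ![i, k, t, p, t'] y =
      -contract G y (fun l m => weyl G ![t', p, i, l] y * cotton G ![m, k, t] y) -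
      contract G y (fun l m =>
        kulkarniNomizu G (schouten G) ![t', p, i, l] y * cotton G ![m, k, t] y) -
      contract G y (fun l m => riemann G ![t', p, k, l] y * cotton G ![i, m, t] y) -
      contract G y (fun l m => riemann G ![t', p, t, l] y * cotton G ![i, k, m] y) := by
    intro k p t t'
    rw [h.covDeriv_comm_three hy h.smooth_cotton, h.sum_riemannUp_mul hy, h.sum_riemannUp_mul hy,
      h.sum_riemannUp_mul hy]
    simp only [weyl_eq hn, sub_mul, contract_sub]
    ring
  have hA := h.contract_kulkarniNomizu_mul_cotton hn hy i
  have hB : contract G y (fun k p => contract G y fun t t' => contract G y fun l m =>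
      riemann G ![t', p, k, l] y * cotton G ![i, m, t] y) = 0 := by
    rw [contract_comm]
    have e : ∀ t t', contract G y (fun k p => contract G y fun l m =>
        riemann G ![t', p, k, l] y * cotton G ![i, m, t] y) =
        contract G y (fun l m => -ricci G ![t', l] y * cotton G ![i, m, t] y) := fun t t' => by
      rw [contract_comm]
      refine contract_congr fun l m => ?_
      rw [contract_mul_const, h.contract_swap hy fun p k => riemann G ![t', p, k, l] y,
        h.contract_riemann_second_third hy]
    simp only [e]
    rw [h.contract_swap hy fun t' t => contract G y fun l m =>
      -ricci G ![t', l] y * cotton G ![i, m, t] y]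
    exact contract_symm_mul_antisymm (fun t l => -ricci G ![t, l] y)
      (fun t m => cotton G ![i, m, t] y) (fun t l => by rw [h.ricci_symm hy])
      (fun t m => h.cotton_antisymm hn hy i m t)
  have hC : contract G y (fun k p => contract G y fun t t' => contract G y fun l m =>
      riemann G ![t', p, t, l] y * cotton G ![i, k, m] y) = 0 := by
    have e : ∀ k p, contract G y (fun t t' => contract G y fun l m =>
        riemann G ![t', p, t, l] y * cotton G ![i, k, m] y) =
        contract G y (fun l m => ricci G ![p, l] y * cotton G ![i, k, m] y) := fun k p => by
      rw [contract_comm]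
      refine contract_congr fun l m => ?_
      rw [contract_mul_const, h.contract_swap hy fun t' t => riemann G ![t', p, t, l] y,
        h.contract_riemann_first_third hy]
    simp only [e]
    rw [h.contract_swap hy fun p k => contract G y fun l m =>
      ricci G ![p, l] y * cotton G ![i, k, m] y]
    exact contract_symm_mul_antisymm (fun t l => ricci G ![t, l] y)
      (fun t m => cotton G ![i, t, m] y) (fun t l => by rw [h.ricci_symm hy])
      (fun t m => h.cotton_antisymm hn hy i t m)
  have hsub : contract G y (fun k p => contract G y fun t t' =>
      (covDeriv G (covDeriv G (cotton G)) ![i, k, t, t', p] y -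
        covDeriv G (covDeriv G (cotton G)) ![i, k, t, p, t'] y)) =
      2 * contract G y (fun k p => contract G y fun t t' =>
        covDeriv G (covDeriv G (cotton G)) ![i, k, t, t', p] y) := by
    simp only [contract_sub]
    linarith
  simp only [hcomm, contract_sub, contract_neg] at hsub
  rw [hA, hB, hC] at hsub
  linear_combination (-1 / 2) * hsub

/-- The contraction `∇_k R_{ab} W_{iakb}` only sees the Cotton tensor. -/
lemma contract_covDeriv_ricci_mul_weyl (h : IsMetricOn G U) (hn : 3 ≤ n) (hy : y ∈ U)
    (i : Fin n) :
    contract G y (fun k p => contract G y fun a a' => contract G y fun b b' =>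
      covDeriv G (ricci G) ![a, b, p] y * weyl G ![i, a', k, b'] y) =
    1 / 2 * contract G y (fun k p => contract G y fun t t' => contract G y fun l m =>
      weyl G ![t', p, i, l] y * cotton G ![m, k, t] y) := by
  have h1 : ∀ a a', contract G y (fun k p => contract G y fun b b' =>
      covDeriv G (ricci G) ![a, b, p] y * weyl G ![i, a', k, b'] y) =
      1 / 2 * contract G y (fun k p => contract G y fun b b' =>
      (cotton G ![a, b, p] y + 1 / (2 * ((n : ℝ) - 1)) *
        (pd p (scalar G) y * G y a b - pd b (scalar G) y * G y a p)) *
          weyl G ![i, a', k, b'] y) := by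
    intro a a'
    have e := contract_mul_antisymm (G := G) (y := y)
      (fun p b => covDeriv G (ricci G) ![a, b, p] y) (fun k b => weyl G ![i, a', k, b] y)
      (fun k b => h.weyl_antisymm_right hn hy i a' k b)
    have e0 := h.contract_swap hy fun p k => contract G y fun b b' =>
      covDeriv G (ricci G) ![a, b, p] y * weyl G ![i, a', k, b'] y
    rw [e0, e, ← h.contract_swap hy]
    refine congrArg _ (contract_congr fun k p => contract_congr fun b b' => ?_)
    congr 1
    change _ = covDeriv G (ricci G) ![a, b, p] y - covDeriv G (ricci G) ![a, p, b] y -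
      1 / (2 * ((n : ℝ) - 1)) * (pd p (scalar G) y * G y a b - pd b (scalar G) y * G y a p) + _
    ring
  have h2 : contract G y (fun a a' => contract G y fun k p => contract G y fun b b' =>
      pd p (scalar G) y * (weyl G ![i, a', k, b'] y * G y a b)) = 0 := by
    rw [contract_comm]
    have e : ∀ k p, contract G y (fun a a' => contract G y fun b b' =>
        pd p (scalar G) y * (weyl G ![i, a', k, b'] y * G y a b)) = 0 := fun k p => by
      simp only [contract_const_mul,
        fun a a' => h.contract_metric_left' hy a fun b' => weyl G ![i, a', k, b'] y]
      rw [h.contract_swap hy fun a' a => weyl G ![i, a', k, a] y, h.contract_weyl hn hy, mul_zero]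
    simp only [e, contract_zero]
  have h3 : contract G y (fun a a' => contract G y fun k p => contract G y fun b b' =>
      pd b (scalar G) y * (weyl G ![i, a', k, b'] y * G y a p)) = 0 := by
    have e : ∀ a a', contract G y (fun k p => contract G y fun b b' =>
        pd b (scalar G) y * (weyl G ![i, a', k, b'] y * G y a p)) =
        contract G y (fun b b' => pd b (scalar G) y * weyl G ![i, a', a, b'] y) := fun a a' => by
      rw [contract_comm]
      refine contract_congr fun b b' => ?_
      rw [contract_const_mul, h.contract_metric' hy a fun k => weyl G ![i, a', k, b'] y]
    simp only [e]
    rw [contract_comm]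
    have e' : ∀ b', contract G y (fun a a' => weyl G ![i, a', a, b'] y) = 0 := fun b' =>
      (h.contract_swap hy fun a' a => weyl G ![i, a', a, b'] y).trans
        (h.contract_weyl_second_third hn hy i b')
    simp only [contract_const_mul, e', mul_zero, contract_zero]
  have h4 : contract G y (fun a a' => contract G y fun k p => contract G y fun b b' =>
      cotton G ![a, b, p] y * weyl G ![i, a', k, b'] y) =
      contract G y (fun k p => contract G y fun t t' => contract G y fun l m =>
      weyl G ![t', p, i, l] y * cotton G ![m, k, t] y) := by
    have e : ∀ k p, contract G y (fun t t' => contract G y fun l m =>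
        weyl G ![t', p, i, l] y * cotton G ![m, k, t] y) =
        contract G y (fun a a' => contract G y fun t t' =>
          cotton G ![a, k, t] y * weyl G ![i, a', t', p] y) := fun k p => by
      rw [contract_comm, ← h.contract_swap hy]
      refine contract_congr fun a a' => contract_congr fun t t' => ?_
      rw [h.weyl_pair_symm hn hy, mul_comm]
    simp only [e]
    refine Eq.trans ?_ (contract_comm fun a a' b b' => contract G y fun t t' =>
      cotton G ![a, b, t] y * weyl G ![i, a', t', b'] y)
    refine contract_congr fun a a' => ?_
    rw [contract_comm]
    refine contract_congr fun b b' => ?_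
    exact h.contract_swap hy fun t t' => cotton G ![a, b, t] y * weyl G ![i, a', t', b'] y
  rw [contract_comm]
  simp only [h1]
  have e : ∀ a a' k p b b', (cotton G ![a, b, p] y + 1 / (2 * ((n : ℝ) - 1)) *
        (pd p (scalar G) y * G y a b - pd b (scalar G) y * G y a p)) * weyl G ![i, a', k, b'] y =
      cotton G ![a, b, p] y * weyl G ![i, a', k, b'] y + 1 / (2 * ((n : ℝ) - 1)) *
        (pd p (scalar G) y * (weyl G ![i, a', k, b'] y * G y a b) -
          pd b (scalar G) y * (weyl G ![i, a', k, b'] y * G y a p)) := fun a a' k p b b' => by ring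
  simp only [e, contract_const_mul (1 / 2), contract_add, contract_const_mul (1 / (2 * _)),
    contract_sub, h2, h3, h4]
  ring

/-- The full contraction of `∇ Ric` with the Cotton tensor is half the squared norm of the
latter. -/
lemma contract_covDeriv_ricci_mul_cotton (h : IsMetricOn G U) (hn : 3 ≤ n) (hy : y ∈ U) :
    contract G y (fun i i' => contract G y fun k k' => contract G y fun t t' =>
      covDeriv G (ricci G) ![k, t, i'] y * cotton G ![k', t', i] y) =
    1 / 2 * normSq G (cotton G) y := by
  have h1 : ∀ k k', contract G y (fun i i' => contract G y fun t t' =>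
      covDeriv G (ricci G) ![k, t, i'] y * cotton G ![k', t', i] y) =
      1 / 2 * contract G y (fun i i' => contract G y fun t t' =>
      (cotton G ![k, t, i'] y + 1 / (2 * ((n : ℝ) - 1)) *
        (pd i' (scalar G) y * G y k t - pd t (scalar G) y * G y k i')) *
          cotton G ![k', t', i] y) := by
    intro k k'
    have e := contract_mul_antisymm (G := G) (y := y)
      (fun p b => covDeriv G (ricci G) ![k, b, p] y) (fun i t => cotton G ![k', t, i] y)
      (fun i t => h.cotton_antisymm hn hy k' t i)
    have e0 := h.contract_swap hy fun p i => contract G y fun b b' =>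
      covDeriv G (ricci G) ![k, b, p] y * cotton G ![k', b', i] y
    rw [e0, e, ← h.contract_swap hy]
    refine congrArg _ (contract_congr fun i p => contract_congr fun b b' => ?_)
    congr 1
    change _ = covDeriv G (ricci G) ![k, b, p] y - covDeriv G (ricci G) ![k, p, b] y -
      1 / (2 * ((n : ℝ) - 1)) * (pd p (scalar G) y * G y k b - pd b (scalar G) y * G y k p) + _
    ring
  have h2 : contract G y (fun k k' => contract G y fun i i' => contract G y fun t t' =>
      pd i' (scalar G) y * (cotton G ![k', t', i] y * G y k t)) = 0 := by
    rw [contract_comm]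
    have e : ∀ i i', contract G y (fun k k' => contract G y fun t t' =>
        pd i' (scalar G) y * (cotton G ![k', t', i] y * G y k t)) = 0 := fun i i' => by
      simp only [contract_const_mul,
        fun k k' => h.contract_metric_left' hy k fun t' => cotton G ![k', t', i] y]
      rw [h.contract_swap hy fun k' k => cotton G ![k', k, i] y, h.contract_cotton hn hy, mul_zero]
    simp only [e, contract_zero]
  have h3 : contract G y (fun k k' => contract G y fun i i' => contract G y fun t t' =>
      pd t (scalar G) y * (cotton G ![k', t', i] y * G y k i')) = 0 := by
    have e : ∀ k k', contract G y (fun i i' => contract G y fun t t' =>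
        pd t (scalar G) y * (cotton G ![k', t', i] y * G y k i')) =
        contract G y (fun t t' => pd t (scalar G) y * cotton G ![k', t', k] y) := fun k k' => by
      rw [contract_comm]
      refine contract_congr fun t t' => ?_
      rw [contract_const_mul, h.contract_metric' hy k fun i => cotton G ![k', t', i] y]
    simp only [e]
    rw [contract_comm]
    have e' : ∀ t', contract G y (fun k k' => cotton G ![k', t', k] y) = 0 := fun t' =>
      (h.contract_swap hy fun k' k => cotton G ![k', t', k] y).trans
        (h.contract_cotton_first_last hn hy t')
    simp only [contract_const_mul, e', mul_zero, contract_zero]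
  have h4 : contract G y (fun k k' => contract G y fun i i' => contract G y fun t t' =>
      cotton G ![k, t, i'] y * cotton G ![k', t', i] y) = normSq G (cotton G) y := by
    refine contract_congr fun k k' => ?_
    rw [contract_comm]
    refine contract_congr fun t t' => ?_
    exact h.contract_swap hy fun i i' => cotton G ![k, t, i] y * cotton G ![k', t', i'] y
  rw [contract_comm]
  simp only [h1]
  have e : ∀ k k' i i' t t', (cotton G ![k, t, i'] y + 1 / (2 * ((n : ℝ) - 1)) *
        (pd i' (scalar G) y * G y k t - pd t (scalar G) y * G y k i')) * cotton G ![k', t', i] y =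
      cotton G ![k, t, i'] y * cotton G ![k', t', i] y + 1 / (2 * ((n : ℝ) - 1)) *
        (pd i' (scalar G) y * (cotton G ![k', t', i] y * G y k t) -
          pd t (scalar G) y * (cotton G ![k', t', i] y * G y k i')) :=
    fun k k' i i' t t' => by ring
  simp only [e, contract_const_mul (1 / 2), contract_add, contract_const_mul (1 / (2 * _)),
    contract_sub, h2, h3, h4]
  ring

end IsMetricOn

end CottonContractions

/-! ### Gradient Ricci solitons in a coordinate system -/

/-- `φ` is smooth on `U` and satisfies the gradient Ricci soliton equation
`R_{ij} + φ_{ij} = lam g_{ij}` there. -/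
structure IsSolitonOn {n : ℕ} (G : Coord n → Matrix (Fin n) (Fin n) ℝ) (φ : Coord n → ℝ) (lam : ℝ)
    (U : Set (Coord n)) : Prop where
  contDiffOn : ContDiffOn ℝ ∞ φ U
  ricci_add_hessian : ∀ z ∈ U, ∀ i j, ricci G ![i, j] z + hessian G φ ![i, j] z = lam * G z i j

section Soliton

variable {n : ℕ} {G : Coord n → Matrix (Fin n) (Fin n) ℝ} {φ : Coord n → ℝ} {lam : ℝ}
  {U : Set (Coord n)} {y : Coord n}

lemma caoChen_antisymm (i j k : Fin n) : caoChen G φ ![i, j, k] y = -caoChen G φ ![i, k, j] y := by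
  have e : ∀ j k, contract G y (fun t t' =>
      pd t φ y * (ricci G ![t', k] y * G y i j - ricci G ![t', j] y * G y i k)) =
      contract G y (fun t t' => pd t φ y * (ricci G ![t', k] y * G y i j)) -
      contract G y (fun t t' => pd t φ y * (ricci G ![t', j] y * G y i k)) := fun j k => by
    simp only [mul_sub, contract_sub]
  have hD : ∀ j k, caoChen G φ ![i, j, k] y =
    1 / ((n : ℝ) - 2) * (pd k φ y * ricci G ![i, j] y - pd j φ y * ricci G ![i, k] y) +
      1 / (((n : ℝ) - 1) * ((n : ℝ) - 2)) *
        (contract G y fun t t' =>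
          pd t φ y * (ricci G ![t', k] y * G y i j - ricci G ![t', j] y * G y i k)) -
      scalar G y / (((n : ℝ) - 1) * ((n : ℝ) - 2)) *
        (pd k φ y * G y i j - pd j φ y * G y i k) := fun _ _ => rfl
  rw [hD, hD, e, e]
  ring

/-- `(n-2) B_{ij}`, with the divergence of the Cotton tensor in the symmetrized form. -/
lemma IsMetricOn.mul_bach (h : IsMetricOn G U) (hn : 3 ≤ n) (hy : y ∈ U) (i j : Fin n) :
    ((n : ℝ) - 2) * bach G ![i, j] y =
      contract G y (fun k k' => covDeriv G (cotton G) ![i, j, k, k'] y) +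
      contract G y (fun k k' => contract G y fun l l' =>
        ricci G ![k, l] y * weyl G ![i, k', j, l'] y) := by
  obtain ⟨h1, h2⟩ := natCast_sub_ne_zero hn
  have e : bach G ![i, j] y = 1 / ((n : ℝ) - 2) *
      ((contract G y fun k k' => covDeriv G (cotton G) ![j, i, k, k'] y) +
        contract G y fun k k' => contract G y fun l l' =>
          ricci G ![k, l] y * weyl G ![i, k', j, l'] y) := rfl
  rw [e, h.contract_covDeriv_cotton_symm hn hy j i]
  field_simp

namespace IsSolitonOn

lemma smooth_differential (h : IsMetricOn G U) (hs : IsSolitonOn G φ lam U) :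
    SmoothTensorOn (differential φ) U := fun _ => contDiffOn_pd h.isOpen hs.contDiffOn _

lemma smooth_caoChen (h : IsMetricOn G U) (hs : IsSolitonOn G φ lam U) :
    SmoothTensorOn (caoChen G φ) U := fun _ => by
  have hR := h.smooth_ricci
  have hg := h.contDiffOn
  have hφ := contDiffOn_pd h.isOpen hs.contDiffOn
  exact ((contDiffOn_const.mul (((hφ _).mul (hR _)).sub ((hφ _).mul (hR _)))).add
    (contDiffOn_const.mul (h.contDiffOn_contract fun _ _ => (hφ _).mul
      (((hR _).mul (hg _ _)).sub ((hR _).mul (hg _ _)))))).sub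
    ((h.contDiffOn_scalar.div_const _).mul (((hφ _).mul (hg _ _)).sub ((hφ _).mul (hg _ _))))

lemma covDeriv_differential (h : IsMetricOn G U) (hs : IsSolitonOn G φ lam U) (hy : y ∈ U)
    (i j : Fin n) :
    covDeriv G (differential φ) ![i, j] y = lam * G y i j - ricci G ![i, j] y := by
  have e := hs.ricci_add_hessian y hy j i
  change _ + covDeriv G (differential φ) ![i, j] y = _ at e
  rw [h.symm y hy i j, h.ricci_symm hy i j]
  linarith

lemma covDeriv_covDeriv_differential (h : IsMetricOn G U) (hs : IsSolitonOn G φ lam U)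
    (hy : y ∈ U) (i j k : Fin n) :
    covDeriv G (covDeriv G (differential φ)) ![i, j, k] y =
      -covDeriv G (ricci G) ![i, j, k] y := by
  rw [covDeriv_congr h.isOpen hy (T := fun a z => lam * metricTensor G a z - ricci G a z)
    (fun a z hz => ?_), covDeriv_sub h.isOpen hy (fun a => contDiffOn_const.mul
      (h.smooth_metricTensor a)) h.smooth_ricci,
    covDeriv_const_mul h.isOpen hy h.smooth_metricTensor, h.covDeriv_metricTensor hy]
  · ring
  · have ha : a = ![a 0, a 1] := by ext s; fin_cases s <;> rfl
    rw [ha]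
    exact hs.covDeriv_differential h hz (a 0) (a 1)

/-- The commutator of third derivatives of the potential:
`∇_k R_{ij} - ∇_j R_{ik} = -f^t R_{tijk}`. -/
lemma covDeriv_ricci_sub (h : IsMetricOn G U) (hs : IsSolitonOn G φ lam U) (hy : y ∈ U)
    (i j k : Fin n) :
    covDeriv G (ricci G) ![i, j, k] y - covDeriv G (ricci G) ![i, k, j] y =
      -contract G y (fun t t' => pd t φ y * riemann G ![t', i, j, k] y) := by
  have e := h.covDeriv_comm_one hy (hs.smooth_differential h) i j k
  rw [hs.covDeriv_covDeriv_differential h hy, hs.covDeriv_covDeriv_differential h hy,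
    h.sum_riemannUp_mul hy] at e
  have e2 : contract G y (fun l m => riemann G ![j, k, i, l] y * differential φ ![m] y) =
      -contract G y (fun t t' => pd t φ y * riemann G ![t', i, j, k] y) := by
    rw [← h.contract_swap hy, ← contract_neg]
    refine contract_congr fun t t' => ?_
    change _ * pd t φ y = _
    rw [h.riemann_pair_symm hy, riemann_antisymm_left]
    ring
  rw [e2] at e
  linarith

/-- `½ ∇_k R = f^t R_{tk}`. -/
lemma pd_scalar (h : IsMetricOn G U) (hs : IsSolitonOn G φ lam U) (hy : y ∈ U) (k : Fin n) :
    pd k (scalar G) y = 2 * contract G y (fun t t' => pd t φ y * ricci G ![t', k] y) := by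
  have e1 : contract G y (fun i j => covDeriv G (ricci G) ![i, j, k] y -
      covDeriv G (ricci G) ![i, k, j] y) = 1 / 2 * pd k (scalar G) y := by
    rw [contract_sub, ← h.pd_scalar hy]
    simp only [fun i j => h.covDeriv_ricci_symm hy i k j]
    rw [h.contract_covDeriv_ricci hy]
    ring
  simp only [hs.covDeriv_ricci_sub h hy, contract_neg] at e1
  rw [contract_comm] at e1
  have e2 : ∀ t', contract G y (fun i j => riemann G ![t', i, j, k] y) = -ricci G ![t', k] y :=
    fun t' => h.contract_riemann_second_third hy t' k
  simp only [contract_const_mul, e2, mul_neg, contract_neg] at e1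
  linarith

/-- `C_{ijk} + f^t W_{tijk} = D_{ijk}`. -/
theorem cotton_add_weyl (h : IsMetricOn G U) (hn : 3 ≤ n) (hs : IsSolitonOn G φ lam U)
    (hy : y ∈ U) (i j k : Fin n) :
    cotton G ![i, j, k] y + contract G y (fun t t' => pd t φ y * weyl G ![t', i, j, k] y) =
      caoChen G φ ![i, j, k] y := by
  obtain ⟨h1, h2⟩ := natCast_sub_ne_zero hn
  have hC : cotton G ![i, j, k] y =
      covDeriv G (ricci G) ![i, j, k] y - covDeriv G (ricci G) ![i, k, j] y -
      1 / (2 * ((n : ℝ) - 1)) * (pd k (scalar G) y * G y i j - pd j (scalar G) y * G y i k) := rfl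
  have hW : ∀ t t', pd t φ y * weyl G ![t', i, j, k] y =
      pd t φ y * riemann G ![t', i, j, k] y -
      1 / ((n : ℝ) - 2) *
        ((pd t φ y * ricci G ![t', j] y) * G y i k - (pd t φ y * ricci G ![t', k] y) * G y i j +
          ricci G ![i, k] y * (pd t φ y * G y t' j) - ricci G ![i, j] y * (pd t φ y * G y t' k)) +
      scalar G y / (((n : ℝ) - 1) * ((n : ℝ) - 2)) *
        ((pd t φ y * G y t' j) * G y i k - (pd t φ y * G y t' k) * G y i j) := by
    intro t t'
    change pd t φ y * (riemann G ![t', i, j, k] y - 1 / ((n : ℝ) - 2) *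
        (ricci G ![t', j] y * G y i k - ricci G ![t', k] y * G y i j +
          ricci G ![i, k] y * G y t' j - ricci G ![i, j] y * G y t' k) +
      scalar G y / (((n : ℝ) - 1) * ((n : ℝ) - 2)) *
        (G y t' j * G y i k - G y t' k * G y i j)) = _
    ring
  have hD : caoChen G φ ![i, j, k] y =
    1 / ((n : ℝ) - 2) * (pd k φ y * ricci G ![i, j] y - pd j φ y * ricci G ![i, k] y) +
      1 / (((n : ℝ) - 1) * ((n : ℝ) - 2)) *
        (contract G y fun t t' =>
          pd t φ y * (ricci G ![t', k] y * G y i j - ricci G ![t', j] y * G y i k)) -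
      scalar G y / (((n : ℝ) - 1) * ((n : ℝ) - 2)) *
        (pd k φ y * G y i j - pd j φ y * G y i k) := rfl
  have hg : ∀ j, contract G y (fun t t' => pd t φ y * G y t' j) = pd j φ y := fun j =>
    h.contract_metric hy j fun t => pd t φ y
  simp only [mul_sub (pd _ φ y), ← mul_assoc (pd _ φ y)] at hD
  rw [hC, hs.covDeriv_ricci_sub h hy, hD, hs.pd_scalar h hy, hs.pd_scalar h hy]
  simp only [hW, contract_sub, contract_add, contract_const_mul, contract_mul_const, hg]
  field_simp
  ring

lemma smooth_pd_mul_weyl (h : IsMetricOn G U) (hs : IsSolitonOn G φ lam U) :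
    SmoothTensorOn (fun (a : Fin 3 → Fin n) z => contract G z fun t t' =>
      pd t φ z * weyl G ![t', a 0, a 1, a 2] z) U := fun _ =>
  h.contDiffOn_contract fun _ _ => (contDiffOn_pd h.isOpen hs.contDiffOn _).mul (h.smooth_weyl _)

/-- The covariant derivative of the first identity. -/
lemma covDeriv_caoChen (h : IsMetricOn G U) (hn : 3 ≤ n) (hs : IsSolitonOn G φ lam U)
    (hy : y ∈ U) (i j k p : Fin n) :
    covDeriv G (caoChen G φ) ![i, j, k, p] y = covDeriv G (cotton G) ![i, j, k, p] y +
      contract G y (fun t t' =>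
        covDeriv G (differential φ) ![t, p] y * weyl G ![t', i, j, k] y +
        pd t φ y * covDeriv G (weyl G) ![t', i, j, k, p] y) := by
  have dφ := fun t => differentiableAt_of_contDiffOn h.isOpen hy
    (contDiffOn_pd h.isOpen hs.contDiffOn t)
  have dW := fun a => differentiableAt_of_contDiffOn h.isOpen hy (h.smooth_weyl a)
  rw [covDeriv_congr h.isOpen hy (T := fun a z => cotton G a z + contract G z fun t t' =>
      pd t φ z * weyl G ![t', a 0, a 1, a 2] z) (fun a z hz => ?_),
    covDeriv_add h.isOpen hy h.smooth_cotton (hs.smooth_pd_mul_weyl h),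
    h.covDeriv_three_contract hy (S := fun a z => contract G z fun t t' =>
      pd t φ z * weyl G ![t', a 0, a 1, a 2] z)
      (F := fun i j k t t' z => pd t φ z * weyl G ![t', i, j, k] z)
      (fun i j k t t' => (contDiffOn_pd h.isOpen hs.contDiffOn _).mul (h.smooth_weyl _))
      (fun i j k z _ => rfl)]
  · congr 1
    refine contract_congr fun t t' => ?_
    rw [pd_mul (dφ t) (dW _), covDeriv_one, covDeriv_four]
    simp only [sum_mul_mul_left, sum_mul_mul_right]
    change _ = (pd p (pd t φ) y - ∑ m, christoffel G m p t y * pd m φ y) * _ + _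
    ring
  · have ha : a = ![a 0, a 1, a 2] := by ext s; fin_cases s <;> rfl
    conv_lhs => rw [ha]
    rw [← hs.cotton_add_weyl h hn hz, ← ha]

/-- The contraction `R^{kl} W_{ikjl}` appearing in the Bach tensor, obtained from `f_{tk} W_{tijk}`
by means of the soliton equation. -/
lemma contract_covDeriv_differential_mul_weyl (h : IsMetricOn G U) (hn : 3 ≤ n)
    (hs : IsSolitonOn G φ lam U) (hy : y ∈ U) (i j : Fin n) :
    contract G y (fun k p => contract G y fun t t' =>
      covDeriv G (differential φ) ![t, p] y * weyl G ![t', i, j, k] y) =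
    contract G y fun k k' => contract G y fun l l' =>
      ricci G ![k, l] y * weyl G ![i, k', j, l'] y := by
  have e : ∀ t t' k p, covDeriv G (differential φ) ![t, p] y * weyl G ![t', i, j, k] y =
      lam * (weyl G ![t', i, j, k] y * G y t p) + ricci G ![t, p] y * weyl G ![i, t', j, k] y := by
    intro t t' k p
    rw [hs.covDeriv_differential h hy, weyl_antisymm_left hn i t']
    ring
  have e1 : contract G y (fun k p => weyl G ![p, i, j, k] y) = 0 := by
    rw [h.contract_swap hy fun p k => weyl G ![p, i, j, k] y]
    simp only [fun p k => weyl_antisymm_left (G := G) (y := y) hn p i j k, contract_neg,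
      h.contract_weyl hn hy, neg_zero]
  simp only [e, contract_add, contract_const_mul,
    fun k p => h.contract_metric_left hy p fun t' => weyl G ![t', i, j, k] y, e1, mul_zero,
    zero_add]
  rw [contract_comm]
  exact contract_congr fun t t' => h.contract_swap hy fun p k =>
    ricci G ![t, p] y * weyl G ![i, t', j, k] y

/-- `(n-2) B_{ij} - (n-3)/(n-2) f^t C_{jit} = ∇^k D_{ijk}`. -/
theorem bach_sub_cotton (h : IsMetricOn G U) (hn : 3 ≤ n) (hs : IsSolitonOn G φ lam U)
    (hy : y ∈ U) (i j : Fin n) :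
    ((n : ℝ) - 2) * bach G ![i, j] y - ((n : ℝ) - 3) / ((n : ℝ) - 2) *
        contract G y (fun t t' => pd t φ y * cotton G ![j, i, t'] y) =
      contract G y fun k k' => covDeriv G (caoChen G φ) ![i, j, k, k'] y := by
  simp only [hs.covDeriv_caoChen h hn hy, contract_add]
  rw [hs.contract_covDeriv_differential_mul_weyl h hn hy, h.mul_bach hn hy,
    contract_comm (fun k p t t' => pd t φ y * covDeriv G (weyl G) ![t', i, j, k, p] y)]
  simp only [contract_const_mul, h.contract_covDeriv_weyl hn hy, mul_left_comm (pd _ φ y)]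
  ring

end IsSolitonOn

/-- `∇_p (R^{ab} W_{iajb})` by the Leibniz rule. -/
lemma IsMetricOn.covDeriv_ricci_mul_weyl (h : IsMetricOn G U) (hy : y ∈ U) (i j p : Fin n) :
    covDeriv G (fun (a : Fin 2 → Fin n) z => contract G z fun k k' => contract G z fun l l' =>
      ricci G ![k, l] z * weyl G ![a 0, k', a 1, l'] z) ![i, j, p] y =
    contract G y (fun a a' => contract G y fun b b' =>
      covDeriv G (ricci G) ![a, b, p] y * weyl G ![i, a', j, b'] y +
      ricci G ![a, b] y * covDeriv G (weyl G) ![i, a', j, b', p] y) := by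
  have hF : ∀ i j a a' b b', ContDiffOn ℝ ∞ (fun z =>
      ricci G ![a, b] z * weyl G ![i, a', j, b'] z) U :=
    fun i j a a' b b' => (h.smooth_ricci _).mul (h.smooth_weyl _)
  have dR := fun a => differentiableAt_of_contDiffOn h.isOpen hy (h.smooth_ricci a)
  have dW := fun a => differentiableAt_of_contDiffOn h.isOpen hy (h.smooth_weyl a)
  rw [h.covDeriv_two_contract hy (F := fun i j a a' z => contract G z fun b b' =>
      ricci G ![a, b] z * weyl G ![i, a', j, b'] z)
    (fun i j a a' => h.contDiffOn_contract (hF i j a a')) (fun i j z _ => rfl)]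
  refine contract_congr fun a a' => ?_
  refine (covDeriv_four (fun c z => contract G z fun b b' =>
      ricci G ![c 2, b] z * weyl G ![c 0, c 3, c 1, b'] z) i j a a' p).symm.trans ?_
  rw [h.covDeriv_four_contract hy (F := fun i j a a' b b' z =>
      ricci G ![a, b] z * weyl G ![i, a', j, b'] z) hF (fun i j a a' z _ => rfl)]
  refine contract_congr fun b b' => ?_
  rw [pd_mul (dR _) (dW _), covDeriv_two, covDeriv_four]
  simp only [sum_mul_mul_left, sum_mul_mul_right]
  ring

/-- `∇_p (R^{kt} C_{kti})` by the Leibniz rule. -/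
lemma IsMetricOn.covDeriv_ricci_mul_cotton (h : IsMetricOn G U) (hy : y ∈ U) (i p : Fin n) :
    covDeriv G (fun (a : Fin 1 → Fin n) z => contract G z fun k k' => contract G z fun t t' =>
      ricci G ![k, t] z * cotton G ![k', t', a 0] z) ![i, p] y =
    contract G y (fun k k' => contract G y fun t t' =>
      covDeriv G (ricci G) ![k, t, p] y * cotton G ![k', t', i] y +
      ricci G ![k, t] y * covDeriv G (cotton G) ![k', t', i, p] y) := by
  have hF : ∀ i k k' t t', ContDiffOn ℝ ∞ (fun z =>
      ricci G ![k, t] z * cotton G ![k', t', i] z) U :=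
    fun i k k' t t' => (h.smooth_ricci _).mul (h.smooth_cotton _)
  have dR := fun a => differentiableAt_of_contDiffOn h.isOpen hy (h.smooth_ricci a)
  have dC := fun a => differentiableAt_of_contDiffOn h.isOpen hy (h.smooth_cotton a)
  rw [h.covDeriv_one_contract hy (F := fun i k k' z => contract G z fun t t' =>
      ricci G ![k, t] z * cotton G ![k', t', i] z)
    (fun i k k' => h.contDiffOn_contract (hF i k k')) (fun i z _ => rfl)]
  refine contract_congr fun k k' => ?_
  refine (covDeriv_three (fun c z => contract G z fun t t' =>
      ricci G ![c 1, t] z * cotton G ![c 2, t', c 0] z) i k k' p).symm.trans ?_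
  rw [h.covDeriv_three_contract hy (F := fun i k k' t t' z =>
      ricci G ![k, t] z * cotton G ![k', t', i] z) hF (fun i k k' z _ => rfl)]
  refine contract_congr fun t t' => ?_
  rw [pd_mul (dR _) (dC _), covDeriv_two, covDeriv_three]
  simp only [sum_mul_mul_left, sum_mul_mul_right]
  ring

namespace IsSolitonOn

lemma covDeriv_pd_mul_cotton (h : IsMetricOn G U) (hs : IsSolitonOn G φ lam U) (hy : y ∈ U)
    (i j p : Fin n) :
    covDeriv G (fun (a : Fin 2 → Fin n) z => contract G z fun t t' =>
      pd t φ z * cotton G ![a 1, a 0, t'] z) ![i, j, p] y =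
    contract G y (fun t t' => covDeriv G (differential φ) ![t, p] y * cotton G ![j, i, t'] y +
      pd t φ y * covDeriv G (cotton G) ![j, i, t', p] y) := by
  have dφ := fun t => differentiableAt_of_contDiffOn h.isOpen hy
    (contDiffOn_pd h.isOpen hs.contDiffOn t)
  have dC := fun a => differentiableAt_of_contDiffOn h.isOpen hy (h.smooth_cotton a)
  rw [h.covDeriv_two_contract hy (F := fun i j t t' z => pd t φ z * cotton G ![j, i, t'] z)
    (fun i j t t' => (contDiffOn_pd h.isOpen hs.contDiffOn _).mul (h.smooth_cotton _))
    (fun i j z _ => rfl)]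
  refine contract_congr fun t t' => ?_
  rw [pd_mul (dφ t) (dC _), covDeriv_one, covDeriv_three]
  simp only [sum_mul_mul_left, sum_mul_mul_right]
  change _ = (pd p (pd t φ) y - ∑ m, christoffel G m p t y * pd m φ y) * _ + _
  ring

/-- `R^{kt} C_{kti} = (n-2) ∇^k ∇^t D_{itk}`. -/
theorem ricci_mul_cotton (h : IsMetricOn G U) (hn : 3 ≤ n) (hs : IsSolitonOn G φ lam U)
    (hy : y ∈ U) (i : Fin n) :
    contract G y (fun k k' => contract G y fun t t' =>
      ricci G ![k, t] y * cotton G ![k', t', i] y) =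
    ((n : ℝ) - 2) * contract G y fun t t' => contract G y fun k k' =>
      covDeriv G (covDeriv G (caoChen G φ)) ![i, t, k, t', k'] y := by
  obtain ⟨h1, h2⟩ := natCast_sub_ne_zero hn
  set c : ℝ := ((n : ℝ) - 3) / ((n : ℝ) - 2) with hc
  have hD := hs.smooth_caoChen h
  let Y : Tensor n 2 := fun a z => contract G z fun t t' =>
    covDeriv G (cotton G) ![a 0, a 1, t, t'] z
  let Z : Tensor n 2 := fun a z => contract G z fun k k' => contract G z fun l l' =>
    ricci G ![k, l] z * weyl G ![a 0, k', a 1, l'] z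
  let F : Tensor n 2 := fun a z => contract G z fun t t' => pd t φ z * cotton G ![a 1, a 0, t'] z
  let E : Tensor n 2 := fun a z => contract G z fun t t' =>
    covDeriv G (caoChen G φ) ![a 0, t, a 1, t'] z
  have sY : SmoothTensorOn Y U := fun _ => h.contDiffOn_contract fun _ _ =>
    h.smooth_covDeriv h.smooth_cotton _
  have sZ : SmoothTensorOn Z U := fun _ => h.contDiffOn_contract fun _ _ =>
    h.contDiffOn_contract fun _ _ => (h.smooth_ricci _).mul (h.smooth_weyl _)
  have sF : SmoothTensorOn F U := fun _ => h.contDiffOn_contract fun _ _ =>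
    (contDiffOn_pd h.isOpen hs.contDiffOn _).mul (h.smooth_cotton _)
  -- the divergence in the middle slot, expressed by the second identity
  have hE : ∀ a, ∀ z ∈ U, E a z = c * F a z - (Y a z + Z a z) := by
    intro a z hz
    have e := hs.bach_sub_cotton h hn hz (a 0) (a 1)
    rw [h.mul_bach hn hz] at e
    have e2 : E a z =
        -contract G z (fun t t' => covDeriv G (caoChen G φ) ![a 0, a 1, t, t'] z) := by
      rw [← contract_neg]
      refine contract_congr fun t t' => ?_
      rw [covDeriv_perm h.isOpen hz hD (Equiv.swap 1 2) (-1) (fun b w _ => ?_)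
        ![a 0, a 1, t, t'] ![a 0, t, a 1, t'] (fun s => by fin_cases s <;> rfl) rfl, neg_one_mul]
      have hb : b = ![b 0, b 1, b 2] := by ext s; fin_cases s <;> rfl
      have hb' : (fun s => b (Equiv.swap (1 : Fin 3) 2 s)) = ![b 0, b 2, b 1] := by
        ext s; fin_cases s <;> rfl
      rw [neg_one_mul, hb', caoChen_antisymm, ← hb]
    rw [e2, ← e]
    change -(Y a z + Z a z - c * F a z) = _
    ring
  have hcE : ∀ k p, contract G y (fun t t' =>
      covDeriv G (covDeriv G (caoChen G φ)) ![i, t, k, t', p] y) =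
      c * covDeriv G F ![i, k, p] y -
        (covDeriv G Y ![i, k, p] y + covDeriv G Z ![i, k, p] y) := by
    intro k p
    rw [← covDeriv_const_mul h.isOpen hy sF, ← covDeriv_add h.isOpen hy sY sZ,
      ← covDeriv_sub h.isOpen hy (fun a => contDiffOn_const.mul (sF a))
        (fun a => (sY a).add (sZ a)), ← covDeriv_congr h.isOpen hy hE,
      h.covDeriv_two_contract hy (F := fun i k t t' => covDeriv G (caoChen G φ) ![i, t, k, t'])
        (fun i k t t' => h.smooth_covDeriv hD _) (fun i k z _ => rfl)]
    refine contract_congr fun t t' => ?_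
    rw [covDeriv_four]
    ring
  have hY : ∀ k p, covDeriv G Y ![i, k, p] y =
      contract G y (fun t t' => covDeriv G (covDeriv G (cotton G)) ![i, k, t, t', p] y) := by
    intro k p
    rw [h.covDeriv_two_contract hy (F := fun i k t t' => covDeriv G (cotton G) ![i, k, t, t'])
        (fun i k t t' => h.smooth_covDeriv h.smooth_cotton _) (fun i k z _ => rfl)]
    refine contract_congr fun t t' => ?_
    rw [covDeriv_four]
  -- the divergence of the term `R^{ab} W_{iakb}`
  have hQ : contract G y (fun k p => contract G y fun a a' => contract G y fun b b' =>
      ricci G ![a, b] y * covDeriv G (weyl G) ![i, a', k, b', p] y) =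
      c * contract G y (fun k k' => contract G y fun t t' =>
        ricci G ![k, t] y * cotton G ![k', t', i] y) := by
    have e : ∀ a', ∀ b', contract G y (fun k p =>
        covDeriv G (weyl G) ![i, a', k, b', p] y) = c * cotton G ![b', a', i] y := by
      intro a' b'
      simp only [fun k p => h.covDeriv_weyl_antisymm_right hn hy i a' k b' p, contract_neg,
        h.contract_covDeriv_weyl hn hy]
      ring
    rw [contract_comm]
    have e2 : ∀ a a', contract G y (fun k p => contract G y fun b b' =>
        ricci G ![a, b] y * covDeriv G (weyl G) ![i, a', k, b', p] y) =
        c * contract G y fun b b' => ricci G ![b, a] y * cotton G ![b', a', i] y := by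
      intro a a'
      rw [contract_comm, ← contract_const_mul]
      refine contract_congr fun b b' => ?_
      rw [contract_const_mul, e, h.ricci_symm hy]
      ring
    simp only [e2, contract_const_mul]
    rw [contract_comm]
  -- the divergence of the term `f^t C_{kit}`
  have hS : contract G y (fun k p => contract G y fun t t' =>
      covDeriv G (differential φ) ![t, p] y * cotton G ![k, i, t'] y +
      pd t φ y * covDeriv G (cotton G) ![k, i, t', p] y) =
      contract G y (fun k k' => contract G y fun t t' =>
        ricci G ![k, t] y * cotton G ![k', t', i] y) := by
    have e : ∀ k p t t', covDeriv G (differential φ) ![t, p] y * cotton G ![k, i, t'] y =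
        lam * (cotton G ![k, i, t'] y * G y t p) + ricci G ![p, t] y * cotton G ![k, t', i] y := by
      intro k p t t'
      rw [hs.covDeriv_differential h hy, h.ricci_symm hy t p, h.cotton_antisymm hn hy k t' i]
      ring
    simp only [contract_add]
    rw [contract_comm (fun k p t t' => pd t φ y * covDeriv G (cotton G) ![k, i, t', p] y)]
    simp only [e, contract_add, contract_const_mul, h.contract_covDeriv_cotton_first hn hy,
      mul_zero, contract_zero,
      fun k p => h.contract_metric_left hy p fun t' => cotton G ![k, i, t'] y,
      h.contract_cotton_first_last hn hy]
    rw [h.contract_swap hy fun p k => contract G y fun t t' =>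
      ricci G ![p, t] y * cotton G ![k, t', i] y]
    ring
  have hZ : ∀ k p, covDeriv G Z ![i, k, p] y = _ := fun k p => h.covDeriv_ricci_mul_weyl hy i k p
  have hF : ∀ k p, covDeriv G F ![i, k, p] y = _ := fun k p =>
    hs.covDeriv_pd_mul_cotton h hy i k p
  have hQ1 := h.contract_covDeriv_ricci_mul_weyl hn hy i
  have hP := h.contract_covDeriv_covDeriv_cotton hn hy i
  have hlin : contract G y (fun k p => c * covDeriv G F ![i, k, p] y -
      (covDeriv G Y ![i, k, p] y + covDeriv G Z ![i, k, p] y)) =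
      c * contract G y (fun k p => covDeriv G F ![i, k, p] y) -
      (contract G y (fun k p => covDeriv G Y ![i, k, p] y) +
        contract G y (fun k p => covDeriv G Z ![i, k, p] y)) := by
    rw [contract_sub, contract_const_mul, contract_add]
  have hsplit : contract G y (fun k p => covDeriv G Z ![i, k, p] y) =
      1 / 2 * contract G y (fun k p => contract G y fun t t' => contract G y fun l m =>
        weyl G ![t', p, i, l] y * cotton G ![m, k, t] y) +
      c * contract G y (fun k k' => contract G y fun t t' =>
        ricci G ![k, t] y * cotton G ![k', t', i] y) := by
    simp only [hZ, contract_add]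
    rw [hQ1, hQ]
  rw [contract_comm (fun t t' k k' =>
    covDeriv G (covDeriv G (caoChen G φ)) ![i, t, k, t', k'] y)]
  simp only [hcE]
  rw [hlin, hsplit]
  simp only [hY, hF]
  rw [hP, hS]
  field_simp
  ring

/-- `½ |C|² + R^{kt} ∇^i C_{kti} = (n-2) ∇^i ∇^k ∇^t D_{itk}`. -/
theorem normSq_cotton_add (h : IsMetricOn G U) (hn : 3 ≤ n) (hs : IsSolitonOn G φ lam U)
    (hy : y ∈ U) :
    1 / 2 * normSq G (cotton G) y +
      contract G y (fun k k' => contract G y fun t t' => contract G y fun i i' =>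
        ricci G ![k, t] y * covDeriv G (cotton G) ![k', t', i, i'] y) =
    ((n : ℝ) - 2) * contract G y fun t t' => contract G y fun k k' => contract G y fun i i' =>
      covDeriv G (covDeriv G (covDeriv G (caoChen G φ))) ![i, t, k, t', k', i'] y := by
  have hD := h.smooth_covDeriv (h.smooth_covDeriv (hs.smooth_caoChen h))
  let X : Tensor n 1 := fun a z => contract G z fun k k' => contract G z fun t t' =>
      ricci G ![k, t] z * cotton G ![k', t', a 0] z
  let V : Tensor n 1 := fun a z => contract G z fun t t' => contract G z fun k k' =>
      covDeriv G (covDeriv G (caoChen G φ)) ![a 0, t, k, t', k'] z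
  have sV : SmoothTensorOn V U := fun _ => h.contDiffOn_contract fun _ _ =>
    h.contDiffOn_contract fun _ _ => hD _
  have hXV : ∀ i p, covDeriv G X ![i, p] y = ((n : ℝ) - 2) * covDeriv G V ![i, p] y := by
    intro i p
    rw [← covDeriv_const_mul h.isOpen hy sV]
    exact covDeriv_congr h.isOpen hy (fun a z hz => hs.ricci_mul_cotton h hn hz (a 0)) _
  have hV : ∀ i p, covDeriv G V ![i, p] y = contract G y (fun t t' => contract G y fun k k' =>
      covDeriv G (covDeriv G (covDeriv G (caoChen G φ))) ![i, t, k, t', k', p] y) := by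
    intro i p
    rw [h.covDeriv_one_contract hy (F := fun i t t' z => contract G z fun k k' =>
        covDeriv G (covDeriv G (caoChen G φ)) ![i, t, k, t', k'] z)
      (fun i t t' => h.contDiffOn_contract fun _ _ => hD _) (fun i z _ => rfl)]
    refine contract_congr fun t t' => ?_
    refine (covDeriv_three (fun c z => contract G z fun k k' =>
        covDeriv G (covDeriv G (caoChen G φ)) ![c 0, c 1, k, c 2, k'] z) i t t' p).symm.trans ?_
    rw [h.covDeriv_three_contract hy (F := fun i t t' k k' =>
        covDeriv G (covDeriv G (caoChen G φ)) ![i, t, k, t', k'])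
        (fun i t t' k k' => hD _) (fun i t t' z _ => rfl)]
    refine contract_congr fun k k' => ?_
    rw [covDeriv_five]
    ring
  have hX : ∀ i p, covDeriv G X ![i, p] y = _ := fun i p => h.covDeriv_ricci_mul_cotton hy i p
  have key : contract G y (fun i p => covDeriv G X ![i, p] y) =
      ((n : ℝ) - 2) * contract G y (fun i p => covDeriv G V ![i, p] y) := by
    rw [← contract_const_mul]
    exact contract_congr hXV
  simp only [hX, hV, contract_add] at key
  rw [h.contract_covDeriv_ricci_mul_cotton hn hy] at key
  have r1 : contract G y (fun i p => contract G y fun k k' => contract G y fun t t' =>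
      ricci G ![k, t] y * covDeriv G (cotton G) ![k', t', i, p] y) =
      contract G y (fun k k' => contract G y fun t t' => contract G y fun i i' =>
        ricci G ![k, t] y * covDeriv G (cotton G) ![k', t', i, i'] y) := by
    rw [contract_comm]
    exact contract_congr fun k k' => contract_comm _
  have r2 : contract G y (fun i p => contract G y fun t t' => contract G y fun k k' =>
      covDeriv G (covDeriv G (covDeriv G (caoChen G φ))) ![i, t, k, t', k', p] y) =
      contract G y (fun t t' => contract G y fun k k' => contract G y fun i i' =>
      covDeriv G (covDeriv G (covDeriv G (caoChen G φ))) ![i, t, k, t', k', i'] y) := by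
    rw [contract_comm]
    exact contract_congr fun t t' => contract_comm _
  rw [← r1, ← r2, key]

end IsSolitonOn

end Soliton

/-! ### From the manifold to coordinates -/

section Manifold

variable {n : ℕ} {M : Type*} [TopologicalSpace M] [ChartedSpace (Coord n) M]
  [IsManifold (𝓡 n) ∞ M] {e : OpenPartialHomeomorph M (Coord n)}

/-- The coordinate vector fields of a chart are smooth. -/
lemma contMDiffOn_coordVec (he : e ∈ IsManifold.maximalAtlas (𝓡 n) ∞ M) (i : Fin n) :
    ContMDiffOn (𝓡 n) ((𝓡 n).prod 𝓘(ℝ, Coord n)) ∞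
      (fun y => (⟨e.symm y, coordVec e i y⟩ : TangentBundle (𝓡 n) M)) e.target := by
  have : IsManifold (𝓡 n) 1 M := IsManifold.of_le (n := ∞) (by simp)
  have hsymm := contMDiffOn_symm_of_mem_maximalAtlas he
  have htan : ContMDiffOn (𝓡 n).tangent (𝓡 n).tangent ∞
      (tangentMapWithin (𝓡 n) (𝓡 n) e.symm e.target)
      (Bundle.TotalSpace.proj ⁻¹' e.target) :=
    hsymm.contMDiffOn_tangentMapWithin (by simp) e.open_target.uniqueMDiffOn
  have hconst : ContMDiffOn (𝓡 n) (𝓡 n).tangent ∞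
      (fun y : Coord n =>
        (⟨y, (EuclideanSpace.single i 1 : Coord n)⟩ : TangentBundle (𝓡 n) (Coord n))) e.target :=
    contMDiffOn_vectorSpace_iff_contDiffOn.2 contDiffOn_const
  refine (htan.comp hconst fun y hy => hy).congr fun y hy => ?_
  simp only [Function.comp, tangentMapWithin, coordVec]
  rw [mfderivWithin_of_isOpen e.open_target hy]

/-- In every smooth chart the coordinate matrix of a Riemannian metric is a metric on the target
of the chart. -/
lemma isMetricOn_metricCoord (g : Metric n M) (he : e ∈ IsManifold.maximalAtlas (𝓡 n) ∞ M) :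
    IsMetricOn (metricCoord g e) e.target where
  isOpen := e.open_target
  contDiffOn i j := by
    rw [← contMDiffOn_iff_contDiffOn]
    intro y hy
    have hi := contMDiffOn_coordVec he i y hy
    have hj := contMDiffOn_coordVec he j y hy
    have hs := contMDiffOn_symm_of_mem_maximalAtlas he y hy
    have : ContMDiffWithinAt (𝓡 n) ((𝓡 n).prod 𝓘(ℝ)) ∞
        (fun y => Bundle.TotalSpace.mk' ℝ (E := Bundle.Trivial M ℝ) (e.symm y)
          (g.inner (e.symm y) (coordVec e i y) (coordVec e j y))) e.target y := by
      apply ContMDiffWithinAt.clm_bundle_apply₂ (F₁ := Coord n) (F₂ := Coord n)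
      · exact ContMDiffAt.comp_contMDiffWithinAt y g.contMDiff.contMDiffAt hs
      · exact hi
      · exact hj
    simp only [Bundle.contMDiffWithinAt_totalSpace] at this
    exact this.2
  symm y _ i j := g.symm _ _ _
  det_ne_zero y hy := by
    intro hdet
    obtain ⟨v, hv, hGv⟩ := Matrix.exists_mulVec_eq_zero_iff.2 hdet
    have hmd : e.symm.MDifferentiable (𝓡 n) (𝓡 n) :=
      ⟨(contMDiffOn_symm_of_mem_maximalAtlas he).mdifferentiableOn (by simp),
        (contMDiffOn_of_mem_maximalAtlas he).mdifferentiableOn (by simp)⟩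
    have hinj := hmd.mfderiv_injective (x := y) hy
    set w := ∑ i, v i • coordVec e i y with hw
    have hw0 : w ≠ 0 := by
      intro h0
      let L : Coord n →L[ℝ] TangentSpace (𝓡 n) (e.symm y) := mfderiv (𝓡 n) (𝓡 n) e.symm y
      have hL : w = L (∑ i, v i • EuclideanSpace.single i (1 : ℝ)) :=
        ((map_sum L _ _).trans (Finset.sum_congr rfl fun i _ => map_smul L _ _)).symm
      rw [hL] at h0
      have h1 : (∑ i, v i • EuclideanSpace.single i (1 : ℝ) : Coord n) = 0 :=
        hinj (h0.trans (map_zero _).symm)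
      refine hv (funext fun j => ?_)
      have h2 := congrArg (fun x : Coord n => x j) h1
      simpa [Finset.sum_apply, Pi.single_apply] using h2
    have hpos := g.pos (e.symm y) w hw0
    have hzero : g.inner (e.symm y) w w = ∑ i, v i * (metricCoord g e y).mulVec v i := by
      conv_lhs => rw [hw]
      simp only [map_sum, map_smul, sum_apply, smul_apply,
        smul_eq_mul, Matrix.mulVec, dotProduct, Finset.mul_sum, metricCoord, Matrix.of_apply]
      rw [Finset.sum_comm]
      exact Finset.sum_congr rfl fun i _ => Finset.sum_congr rfl fun j _ => by ring
    rw [hzero, hGv] at hpos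
    simp at hpos

/-- A gradient Ricci soliton satisfies the soliton equation in every smooth chart. -/
lemma IsGradientRicciSoliton.exists_isSolitonOn {g : Metric n M} {f : M → ℝ}
    (hf : IsGradientRicciSoliton g f) (he : e ∈ IsManifold.maximalAtlas (𝓡 n) ∞ M) :
    ∃ lam, IsSolitonOn (metricCoord g e) (f ∘ e.symm) lam e.target := by
  obtain ⟨hsm, lam, hlam⟩ := hf
  refine ⟨lam, ?_, hlam e he⟩
  rw [← contMDiffOn_iff_contDiffOn]
  exact hsm.comp_contMDiffOn (contMDiffOn_symm_of_mem_maximalAtlas he)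

end Manifold

end RicciSoliton

theorem proposition3p1 {n : ℕ} (hn : 3 ≤ n) {M : Type*} [TopologicalSpace M]
    [ChartedSpace (Coord n) M] [IsManifold (𝓡 n) ∞ M] (g : Metric n M) (f : M → ℝ)
    (hf : IsGradientRicciSoliton g f)
    (e : OpenPartialHomeomorph M (Coord n)) (he : e ∈ IsManifold.maximalAtlas (𝓡 n) ∞ M)
    (y : Coord n) (hy : y ∈ e.target) :
    let G := metricCoord g e
    let φ := f ∘ e.symm
    let C := cotton G
    let D := caoChen G φ
    (∀ i j k : Fin n,
      C ![i, j, k] y + (contract G y fun t t' => pd t φ y * weyl G ![t', i, j, k] y) =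
        D ![i, j, k] y) ∧
    (∀ i j : Fin n,
      ((n : ℝ) - 2) * bach G ![i, j] y -
          ((n : ℝ) - 3) / ((n : ℝ) - 2) *
            (contract G y fun t t' => pd t φ y * C ![j, i, t'] y) =
        contract G y fun k k' => covDeriv G D ![i, j, k, k'] y) ∧
    (∀ i : Fin n,
      (contract G y fun k k' => contract G y fun t t' =>
          ricci G ![k, t] y * C ![k', t', i] y) =
        ((n : ℝ) - 2) *
          contract G y fun t t' => contract G y fun k k' =>
            covDeriv G (covDeriv G D) ![i, t, k, t', k'] y) ∧
    (1 / 2 * normSq G C y +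
        (contract G y fun k k' => contract G y fun t t' => contract G y fun i i' =>
          ricci G ![k, t] y * covDeriv G C ![k', t', i, i'] y) =
      ((n : ℝ) - 2) *
        contract G y fun t t' => contract G y fun k k' => contract G y fun i i' =>
          covDeriv G (covDeriv G (covDeriv G D)) ![i, t, k, t', k', i'] y) := by
  obtain ⟨lam, hs⟩ := hf.exists_isSolitonOn he
  have h := isMetricOn_metricCoord g he
  exact ⟨hs.cotton_add_weyl h hn hy, hs.bach_sub_cotton h hn hy, hs.ricci_mul_cotton h hn hy,
    hs.normSq_cotton_add h hn hy⟩
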